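/- **Theorem 1.1.** Let $n$ be a natural number. (i) Let $u:\mathbb{R}^n\to\mathbb{R}$ be a smooth function which is convex in the sense that its Hessian $D^2u(x)$ is positive definite for every $x\in\mathbb{R}^n$, and suppose that $$\log\det D^2u(x)=\tfrac12\,x\cdot Du(x)-u(x)\qquad\text{for all }x\in\mathbb{R}^n .$$ Then $u$ is the quadratic polynomial $$u(x)=u(0)+\tfrac12\langle D^2u(0)x,x\rangle\qquad\text{for all }x\in\mathbb{R}^n .$$ (ii) Let $\mathbb{R}^{2n}_n$ be $\mathbb{R}^n\times\mathbb{R}^n$ with null coordinates $(x,y)$ and the indefinite metric $ds^2=\sum_i dx_i\,dy_i$, that is, $\langle (a,b),(c,d)\rangle=\tfrac12(a\cdot d+b\cdot c)$. Let $f:\mathbb{R}^n\to\mathbb{R}^n$ be smooth, and let $M=\{(x,f(x)) : x\in\mathbb{R}^n\}$ be its entire graph in $\mathbb{R}^{2n}_n$. Suppose that $M$ is space-like (the induced metric is positive definite), Lagrangian (the form $\sum_i dx_i\wedge dy_i$ vanishes on $M$), and a self-shrinker, i.e. $H=-\tfrac12X^N$, where $X$ is the position vector, $X^N$ is its part normal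 to $M$ with respect to $ds^2$, and $H$ is the mean curvature vector (the trace of the second fundamental form with respect to the induced metric). Then $M$ is flat: it is a linear subspace of $\mathbb{R}^{2n}_n$, so its second fundamental form and the Riemann curvature tensor of its induced metric vanish identically. -/

import Mathlib

open scoped ContDiff

noncomputable section

namespace SelfShrinker

/-- Euclidean space `ℝⁿ`. -/
abbrev E (n : ℕ) : Type := EuclideanSpace ℝ (Fin n)

/-- The `i`-th standard basis vector of `ℝⁿ`. -/
def e {n : ℕ} (i : Fin n) : E n := EuclideanSpace.single i (1 : ℝ)

/-- The partial derivative `∂ᵢ f`, for `f` with values in any normed space. -/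
def partialDeriv {n : ℕ} {V : Type*} [NormedAddCommGroup V] [NormedSpace ℝ V]
    (i : Fin n) (f : E n → V) (x : E n) : V :=
  fderiv ℝ f x (e i)

/-- The Hessian matrix `D²u(x) = (∂ᵢ∂ⱼu(x))`. -/
def hessian {n : ℕ} (u : E n → ℝ) (x : E n) : Matrix (Fin n) (Fin n) ℝ :=
  Matrix.of fun i j => partialDeriv i (partialDeriv j u) x

/-- `u` is an entire smooth convex solution, in the sense `D²u > 0`, of
`log det D²u = ½ x · Du - u` on `ℝⁿ`. -/
structure IsEntireConvexSolution {n : ℕ} (u : E n → ℝ) : Prop where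
  smooth : ContDiff ℝ ∞ u
  convex : ∀ x, (hessian u x).PosDef
  eqn : ∀ x, Real.log (hessian u x).det = (1 / 2 : ℝ) * inner ℝ x (gradient u x) - u x

/-! ## The ambient space with null coordinates -/

/-- The underlying vector space of `ℝ²ⁿₙ`, with null coordinates `(x, y)`. -/
abbrev Ambient (n : ℕ) : Type := E n × E n

/-- The indefinite metric `ds² = ∑ᵢ dxᵢ dyᵢ`, as a symmetric bilinear form: it is the
polarization of the quadratic form `(x, y) ↦ ∑ᵢ xᵢ yᵢ`. -/
def nullForm {n : ℕ} (p q : Ambient n) : ℝ :=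
  (1 / 2 : ℝ) * (inner ℝ p.1 q.2 + inner ℝ p.2 q.1)

/-- The standard symplectic form `∑ᵢ dxᵢ ∧ dyᵢ`. -/
def symplecticForm {n : ℕ} (p q : Ambient n) : ℝ :=
  inner ℝ p.1 q.2 - inner ℝ p.2 q.1

/-! ## Extrinsic geometry of a parametrized `n`-dimensional submanifold `F : ℝⁿ → ℝ²ⁿₙ` -/

/-- The coefficients `gᵢⱼ = ⟨∂ᵢF, ∂ⱼF⟩` of the induced metric. -/
def inducedMetric {n : ℕ} (F : E n → Ambient n) (x : E n) : Matrix (Fin n) (Fin n) ℝ :=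
  Matrix.of fun i j => nullForm (partialDeriv i F x) (partialDeriv j F x)

/-- The submanifold is space-like: its induced metric is positive definite. -/
def IsSpaceLike {n : ℕ} (F : E n → Ambient n) : Prop :=
  ∀ x, (inducedMetric F x).PosDef

/-- The submanifold (of half the ambient dimension) is Lagrangian: the symplectic form
vanishes on its tangent spaces. -/
def IsLagrangian {n : ℕ} (F : E n → Ambient n) : Prop :=
  ∀ x i j, symplecticForm (partialDeriv i F x) (partialDeriv j F x) = 0

/-- The normal part `pᴺ = p - ∑ᵢⱼ gⁱʲ ⟨p, ∂ᵢF⟩ ∂ⱼF` at `F x` of an ambient vector `p`;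
it is the orthogonal projection to the normal space where the induced metric is
non-degenerate. -/
def normalPart {n : ℕ} (F : E n → Ambient n) (x : E n) (p : Ambient n) : Ambient n :=
  p - ∑ i, ∑ j, ((inducedMetric F x)⁻¹ i j * nullForm p (partialDeriv i F x)) •
    partialDeriv j F x

/-- The second fundamental form `Bᵢⱼ = (∂ᵢ∂ⱼF)ᴺ`. -/
def secondFundamentalForm {n : ℕ} (F : E n → Ambient n) (x : E n) (i j : Fin n) : Ambient n :=
  normalPart F x (partialDeriv i (partialDeriv j F) x)

/-- The mean curvature vector `H = ∑ᵢⱼ gⁱʲ Bᵢⱼ`. -/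
def meanCurvature {n : ℕ} (F : E n → Ambient n) (x : E n) : Ambient n :=
  ∑ i, ∑ j, (inducedMetric F x)⁻¹ i j • secondFundamentalForm F x i j

/-- The self-shrinker equation `H = - Xᴺ / 2`. -/
def IsSelfShrinker {n : ℕ} (F : E n → Ambient n) : Prop :=
  ∀ x, meanCurvature F x = -((1 / 2 : ℝ) • normalPart F x (F x))

/-- The second fundamental form vanishes identically. -/
def IsTotallyGeodesic {n : ℕ} (F : E n → Ambient n) : Prop :=
  ∀ x i j, secondFundamentalForm F x i j = 0

/-! ## Intrinsic curvature -/

/-- The Christoffel symbols `Γᵏᵢⱼ = ½ ∑ₗ gᵏˡ (∂ᵢgⱼₗ + ∂ⱼgᵢₗ - ∂ₗgᵢⱼ)` of a metric `g` in the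
global coordinates of `ℝⁿ`. -/
def christoffel {n : ℕ} (g : E n → Matrix (Fin n) (Fin n) ℝ) (k i j : Fin n) (x : E n) : ℝ :=
  (1 / 2 : ℝ) * ∑ l, (g x)⁻¹ k l *
    (partialDeriv i (fun y => g y j l) x + partialDeriv j (fun y => g y i l) x
      - partialDeriv l (fun y => g y i j) x)

/-- The components `Rˡₖᵢⱼ = ∂ᵢΓˡⱼₖ - ∂ⱼΓˡᵢₖ + ∑ₘ (Γˡᵢₘ Γᵐⱼₖ - Γˡⱼₘ Γᵐᵢₖ)` of the Riemann
curvature tensor of `g`. -/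
def riemann {n : ℕ} (g : E n → Matrix (Fin n) (Fin n) ℝ) (l k i j : Fin n) (x : E n) : ℝ :=
  partialDeriv i (christoffel g l j k) x - partialDeriv j (christoffel g l i k) x
    + ∑ m, (christoffel g l i m x * christoffel g m j k x
      - christoffel g l j m x * christoffel g m i k x)

/-- The induced metric is flat: its Riemann curvature tensor vanishes. -/
def HasFlatMetric {n : ℕ} (F : E n → Ambient n) : Prop :=
  ∀ x l k i j, riemann (inducedMetric F) l k i j x = 0

/-- The parametrization `x ↦ (x, f(x))` of the entire graph of `f`. -/
def graphMap {n : ℕ} (f : E n → E n) (x : E n) : Ambient n := (x, f x)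

end SelfShrinker

end

noncomputable section

namespace SelfShrinker

open Matrix Filter Topology

/-! ## Positive definite matrices -/

section MatrixInequalities

variable {n : ℕ} {A B : Matrix (Fin n) (Fin n) ℝ}

/-! The proof studies the phase φ = ½ x·Du − u, which equals log det D²u. Differentiating the two
expressions for φ gives tr((D²u)⁻¹ D²φ) = ½ x·Dφ, a linear elliptic equation without zeroth-order
term (`trace_hessian_phase`). If φ attains its maximum, the strong maximum principle
(`eq_of_forall_le_of_subharmonic`) makes it constant. Then D²φ = 0 says that D²u is constant along
rays, hence everywhere by continuity at the origin, and Dφ = 0 says Du = D²u·x; so u is quadratic.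

The work is in showing that the maximum is attained (`exists_phase_le`). First, u is proper
(`exists_norm_le`): if u were bounded above at a far point X, convexity would bound it on a long
thin ellipsoid whose defining matrix has determinant of order |X|⁻². Touching u there by a multiple
of the ellipsoid's quadratic form (`exists_touching`) yields a point where log det D²u is bounded
above through this small determinant while φ is bounded below, which limits |X|. Second, exp(−φ/4) +
δ exp(u/4) then has a minimum, and the equation at the minimum point p forces p·Du(p) ≤ 4n, so u(p)
≤ u(0) + 4n whatever δ is (`exists_phase_comparison`). These points stay in one compact set as δ →
0, so φ is bounded by its maximum there.

For graphs, the Lagrangian condition gives a potential U with DU = f, and the induced metric is D²U.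
The self-shrinker equation becomes the gradient of the scalar equation, so U solves the latter up to
an additive constant (`exists_solution`), and the first part makes f linear. -/

theorem exists_eq_transpose_mul_self (hA : A.PosSemidef) :
    ∃ C : Matrix (Fin n) (Fin n) ℝ, A = Cᵀ * C := by
  open scoped MatrixOrder in
  obtain ⟨C, hC⟩ := CStarAlgebra.nonneg_iff_eq_star_mul_self.mp hA.nonneg
  exact ⟨C, by rw [hC, star_eq_conjTranspose, conjTranspose_eq_transpose_of_trivial]⟩

/-- With A = CᵀC the trace is that of the positive semidefinite matrix C B Cᵀ. At a minimum this is
how the Hessian test is contracted with elliptic coefficients. -/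
theorem trace_mul_nonneg (hA : A.PosSemidef) (hB : B.PosSemidef) : 0 ≤ (A * B).trace := by
  obtain ⟨C, rfl⟩ := exists_eq_transpose_mul_self hA
  rw [Matrix.mul_assoc, Matrix.trace_mul_comm]
  have h := hB.mul_mul_conjTranspose_same C
  rw [conjTranspose_eq_transpose_of_trivial] at h
  exact h.trace_nonneg

theorem log_det_le_trace_sub (hA : A.PosDef) : Real.log A.det ≤ A.trace - n := by
  rw [hA.isHermitian.det_eq_prod_eigenvalues, hA.isHermitian.trace_eq_sum_eigenvalues]
  simp only [RCLike.ofReal_real_eq_id, id]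
  rw [Real.log_prod (fun i _ => (hA.eigenvalues_pos i).ne')]
  calc ∑ i, Real.log (hA.isHermitian.eigenvalues i)
      ≤ ∑ i, (hA.isHermitian.eigenvalues i - 1) :=
        Finset.sum_le_sum fun i _ => Real.log_le_sub_one_of_pos (hA.eigenvalues_pos i)
    _ = _ := by simp [Finset.sum_sub_distrib]

/-- Concavity of `log det`, in the form that its graph lies below its tangent planes. -/
theorem log_det_le (hA : A.PosDef) (hB : B.PosDef) :
    Real.log A.det ≤ Real.log B.det + (B⁻¹ * A).trace - n := by
  -- Factoring B⁻¹ = CᵀC reduces the claim to the case B = 1 for the congruent matrix C A Cᵀ, where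
  -- it is log t ≤ t − 1 on eigenvalues.
  obtain ⟨C, hC⟩ := exists_eq_transpose_mul_self hB.inv.posSemidef
  have hdet : C.det * C.det = (B.det)⁻¹ := by
    rw [← Ring.inverse_eq_inv', ← Matrix.det_nonsing_inv, hC, det_mul, det_transpose]
  have hBd := hB.det_pos
  have hAd := hA.det_pos
  have hC0 : C.det ≠ 0 := by
    rintro h
    rw [h, zero_mul] at hdet
    exact (inv_pos.mpr hBd).ne hdet
  have hCu : IsUnit C := (Matrix.isUnit_iff_isUnit_det C).mpr (isUnit_iff_ne_zero.mpr hC0)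
  have hM : (C * A * Cᵀ).PosDef := by
    have h := (Matrix.IsUnit.posDef_star_right_conjugate_iff (x := A) hCu).mpr hA
    rwa [star_eq_conjTranspose, conjTranspose_eq_transpose_of_trivial] at h
  have h := log_det_le_trace_sub hM
  have h1 : (C * A * Cᵀ).det = (B.det)⁻¹ * A.det := by
    rw [det_mul, det_mul, det_transpose, ← hdet]; ring
  have h2 : (C * A * Cᵀ).trace = (B⁻¹ * A).trace := by
    rw [Matrix.trace_mul_comm, ← Matrix.mul_assoc, hC]
  rw [h1, h2, Real.log_mul (inv_pos.mpr hBd).ne' hAd.ne', Real.log_inv] at h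
  linarith

theorem log_det_mono (hA : A.PosDef) (hB : B.PosDef) (h : (B - A).PosSemidef) :
    Real.log A.det ≤ Real.log B.det := by
  have h1 := log_det_le hA hB
  have h2 := trace_mul_nonneg hB.inv.posSemidef h
  rw [Matrix.mul_sub, Matrix.nonsing_inv_mul _ (isUnit_iff_ne_zero.mpr hB.det_pos.ne'),
    Matrix.trace_sub, Matrix.trace_one, Fintype.card_fin] at h2
  linarith

/-- Jacobi's formula for the derivative of `log det` along a curve. -/
theorem deriv_log_det {G : ℝ → Matrix (Fin n) (Fin n) ℝ} {G' : Matrix (Fin n) (Fin n) ℝ}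
    {t₀ d : ℝ} (hG : ∀ t, (G t).PosDef) (hG' : ∀ i j, HasDerivAt (fun t => G t i j) (G' i j) t₀)
    (hd : HasDerivAt (fun t => Real.log (G t).det) d t₀) : d = ((G t₀)⁻¹ * G').trace := by
  have h1 : HasDerivAt (fun t => ((G t₀)⁻¹ * G t).trace) ((G t₀)⁻¹ * G').trace t₀ := by
    simp only [Matrix.trace, Matrix.diag, Matrix.mul_apply]
    exact HasDerivAt.fun_sum fun i _ => HasDerivAt.fun_sum fun j _ => (hG' j i).const_mul _
  have h2 := hd.sub h1
  -- Concavity makes the difference from the tangent plane maximal at t₀, so the two derivatives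
  -- agree there without expanding the determinant.
  have hmax : IsLocalMax ((fun t => Real.log (G t).det) - fun t => ((G t₀)⁻¹ * G t).trace) t₀ := by
    refine Filter.Eventually.of_forall fun t => ?_
    have h := log_det_le (hG t) (hG t₀)
    have h' : ((G t₀)⁻¹ * G t₀).trace = n := by
      rw [Matrix.nonsing_inv_mul _ (isUnit_iff_ne_zero.mpr (hG t₀).det_pos.ne'),
        Matrix.trace_one, Fintype.card_fin]
    simp only [Pi.sub_apply]
    linarith
  linarith [hmax.hasDerivAt_eq_zero h2]

theorem trace_mul_vecMulVec (M : Matrix (Fin n) (Fin n) ℝ) (v w : Fin n → ℝ) :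
    (M * vecMulVec v w).trace = w ⬝ᵥ (M *ᵥ v) := by
  rw [Matrix.mul_vecMulVec, Matrix.trace_vecMulVec, dotProduct_comm]

end MatrixInequalities

/-! ## Derivatives in coordinates -/

section Calculus

variable {n : ℕ}

/-- The gradient in coordinates. -/
def grad (f : E n → ℝ) (x : E n) : Fin n → ℝ := fun i => partialDeriv i f x

theorem sum_smul_e (v : E n) : ∑ i, v i • (e i : E n) = v := by
  ext j
  simp [e, Pi.single_apply]

theorem fderiv_eq_sum {V : Type*} [NormedAddCommGroup V] [NormedSpace ℝ V] (f : E n → V)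
    (x v : E n) : fderiv ℝ f x v = ∑ i, v i • partialDeriv i f x := by
  conv_lhs => rw [← sum_smul_e v]
  simp [partialDeriv]

theorem fderiv_eq_dotProduct (f : E n → ℝ) (x v : E n) :
    fderiv ℝ f x v = v.ofLp ⬝ᵥ grad f x := by
  simp [fderiv_eq_sum, dotProduct, grad]

theorem inner_gradient_eq (f : E n → ℝ) (x v : E n) :
    inner ℝ v (gradient f x) = v.ofLp ⬝ᵥ grad f x := by
  rw [real_inner_comm, gradient, InnerProductSpace.toDual_symm_apply, fderiv_eq_dotProduct]

theorem contDiff_partialDeriv {V : Type*} [NormedAddCommGroup V] [NormedSpace ℝ V]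
    {f : E n → V} (hf : ContDiff ℝ ∞ f) (i : Fin n) : ContDiff ℝ ∞ (partialDeriv i f) := by
  have h : ContDiff ℝ ∞ (fderiv ℝ f) := hf.fderiv_right (by simp)
  exact h.clm_apply contDiff_const

theorem contDiff_hessian {f : E n → ℝ} (hf : ContDiff ℝ ∞ f) (i j : Fin n) :
    ContDiff ℝ ∞ fun x => hessian f x i j :=
  contDiff_partialDeriv (contDiff_partialDeriv hf j) i

theorem partialDeriv_comm {V : Type*} [NormedAddCommGroup V] [NormedSpace ℝ V]
    {f : E n → V} (hf : ContDiff ℝ ∞ f) (i j : Fin n) (x : E n) :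
    partialDeriv i (partialDeriv j f) x = partialDeriv j (partialDeriv i f) x := by
  have h : DifferentiableAt ℝ (fderiv ℝ f) x :=
    ((hf.fderiv_right (m := ∞) (by simp)).differentiable (by simp)) x
  have key : ∀ a b : Fin n, partialDeriv a (partialDeriv b f) x
      = fderiv ℝ (fderiv ℝ f) x (e a) (e b) := by
    intro a b
    unfold partialDeriv
    rw [fderiv_clm_apply h (differentiableAt_const _)]
    simp
  rw [key, key]
  exact (hf.contDiffAt.isSymmSndFDerivAt
    (by rw [minSmoothness_of_isRCLikeNormedField]; exact WithTop.coe_le_coe.mpr le_top)) _ _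

theorem hessian_isHermitian {f : E n → ℝ} (hf : ContDiff ℝ ∞ f) (x : E n) :
    (hessian f x).IsHermitian := by
  ext i j
  simp only [conjTranspose_apply, star_trivial, hessian, of_apply]
  exact partialDeriv_comm hf j i x

theorem hasDerivAt_line {V : Type*} [NormedAddCommGroup V] [NormedSpace ℝ V] {f : E n → V}
    (hf : Differentiable ℝ f) (x v : E n) (t : ℝ) :
    HasDerivAt (fun t : ℝ => f (x + t • v)) (∑ i, v i • partialDeriv i f (x + t • v)) t := by
  rw [← fderiv_eq_sum]
  have h : HasDerivAt (fun t : ℝ => x + t • v) v t := by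
    simpa using ((hasDerivAt_id t).smul_const v).const_add x
  exact (hf (x + t • v)).hasFDerivAt.comp_hasDerivAt t h

theorem hasDerivAt_line_real {f : E n → ℝ} (hf : Differentiable ℝ f) (x v : E n) (t : ℝ) :
    HasDerivAt (fun t : ℝ => f (x + t • v)) (v.ofLp ⬝ᵥ grad f (x + t • v)) t := by
  simpa [dotProduct, grad] using hasDerivAt_line hf x v t

theorem hasDerivAt_line_grad {f : E n → ℝ} (hf : ContDiff ℝ ∞ f) (x v w : E n) (t : ℝ) :
    HasDerivAt (fun t : ℝ => w.ofLp ⬝ᵥ grad f (x + t • v))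
      (w.ofLp ⬝ᵥ (hessian f (x + t • v) *ᵥ v.ofLp)) t := by
  simp only [dotProduct, grad]
  refine HasDerivAt.fun_sum fun i _ => ?_
  have h := (hasDerivAt_line ((contDiff_partialDeriv hf i).differentiable (by simp)) x v t).const_mul
    (w i)
  have heq : (hessian f (x + t • v) *ᵥ v.ofLp) i
      = ∑ j, v j • partialDeriv j (partialDeriv i f) (x + t • v) :=
 by
    simp only [mulVec, dotProduct, hessian, of_apply, smul_eq_mul]
    exact Finset.sum_congr rfl fun j _ => by rw [mul_comm, partialDeriv_comm hf]
  rw [heq]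
  exact h

theorem grad_eq_zero_of_isLocalMin {f : E n → ℝ} {x : E n} (h : IsLocalMin f x) :
    grad f x = 0 := by
  ext i
  simp [grad, partialDeriv, h.fderiv_eq_zero]

theorem posSemidef_of_isLocalMin {f : E n → ℝ} (hf : ContDiff ℝ ∞ f) {x : E n}
    (h : IsLocalMin f x) : (hessian f x).PosSemidef := by
  refine PosSemidef.of_dotProduct_mulVec_nonneg (hessian_isHermitian hf x) fun w => ?_
  rw [star_trivial]
  set v : E n := WithLp.toLp 2 w with hv
  set g : ℝ → ℝ := fun t => f (x + t • v) with hg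
  have hd : deriv g = fun t => v.ofLp ⬝ᵥ grad f (x + t • v) :=
    funext fun t => (hasDerivAt_line_real (hf.differentiable (by simp)) x v t).deriv
  have hdd : deriv (deriv g) 0 = w ⬝ᵥ (hessian f x *ᵥ w) := by
    rw [hd, (hasDerivAt_line_grad hf x v v 0).deriv]
    simp [hv]
  have hgc : ContinuousAt g 0 :=
    (hasDerivAt_line_real (hf.differentiable (by simp)) x v 0).continuousAt
  have hmin : IsLocalMin g 0 := by
    have hc : Tendsto (fun t : ℝ => x + t • v) (𝓝 0) (𝓝 x) := by
      have : Continuous fun t : ℝ => x + t • v := by fun_prop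
      simpa using this.tendsto 0
    have := hc.eventually h
    simpa [IsLocalMin, IsMinFilter, hg] using this
  rw [← hdd]
  by_contra! hneg
  -- A negative second derivative would make 0 a local maximum as well, so g would be locally
  -- constant and its second derivative zero.
  have hmax := isLocalMax_of_deriv_deriv_neg hneg hmin.deriv_eq_zero hgc
  have hconst : g =ᶠ[𝓝 0] fun _ => g 0 := by
    filter_upwards [hmin, hmax] with t h1 h2 using le_antisymm h2 h1
  have h0 : deriv (deriv g) 0 = 0 := by
    rw [hconst.deriv.deriv_eq]
    simp
  exact hneg.ne h0

theorem grad_add {f g : E n → ℝ} (hf : Differentiable ℝ f) (hg : Differentiable ℝ g) (x : E n) :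
    grad (fun y => f y + g y) x = grad f x + grad g x := by
  ext i
  simp [grad, partialDeriv, fderiv_fun_add (hf x) (hg x)]

theorem hessian_add {f g : E n → ℝ} (hf : ContDiff ℝ ∞ f) (hg : ContDiff ℝ ∞ g) (x : E n) :
    hessian (fun y => f y + g y) x = hessian f x + hessian g x := by
  ext i j
  simp only [hessian, of_apply, Matrix.add_apply]
  have h : partialDeriv j (fun y => f y + g y) = fun y => partialDeriv j f y + partialDeriv j g y :=
    funext fun y => congrFun
      (grad_add (hf.differentiable (by simp)) (hg.differentiable (by simp)) y) j
  rw [h]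
  exact congrFun (grad_add ((contDiff_partialDeriv hf j).differentiable (by simp))
    ((contDiff_partialDeriv hg j).differentiable (by simp)) x) i

theorem grad_comp {g g' : ℝ → ℝ} (hg : ∀ t, HasDerivAt g (g' t) t) {f : E n → ℝ}
    (hf : Differentiable ℝ f) (x : E n) :
    grad (fun y => g (f y)) x = g' (f x) • grad f x := by
  ext i
  simp only [grad, partialDeriv, Pi.smul_apply, smul_eq_mul]
  have h := ((hg (f x)).comp_hasFDerivAt x (hf x).hasFDerivAt).fderiv
  simp only [Function.comp_def] at h
  rw [h]
  simp

theorem partialDeriv_mul {f g : E n → ℝ} (hf : Differentiable ℝ f) (hg : Differentiable ℝ g)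
    (i : Fin n) (x : E n) : partialDeriv i (fun y => f y * g y) x
      = f x * partialDeriv i g x + g x * partialDeriv i f x := by
  simp [partialDeriv, fderiv_fun_mul (hf x) (hg x)]

theorem hessian_comp {g g' g'' : ℝ → ℝ} (hg : ∀ t, HasDerivAt g (g' t) t)
    (hg' : ∀ t, HasDerivAt g' (g'' t) t) {f : E n → ℝ} (hf : ContDiff ℝ ∞ f) (x : E n) :
    hessian (fun y => g (f y)) x
      = g' (f x) • hessian f x + g'' (f x) • vecMulVec (grad f x) (grad f x) := by
  ext i j
  have hfd := hf.differentiable (by simp)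
  have h : partialDeriv j (fun y => g (f y)) = fun y => g' (f y) * partialDeriv j f y :=
    funext fun y => congrFun (grad_comp hg hfd y) j
  have h' : partialDeriv i (fun y => g' (f y)) x = g'' (f x) * partialDeriv i f x :=
    congrFun (grad_comp hg' hfd x) i
  have hd : Differentiable ℝ fun y => g' (f y) := fun y =>
    ((hg' (f y)).comp_hasFDerivAt y (hfd y).hasFDerivAt).differentiableAt
  simp only [hessian, of_apply, Matrix.add_apply, Matrix.smul_apply, smul_eq_mul, vecMulVec_apply, grad]
  rw [h, partialDeriv_mul hd ((contDiff_partialDeriv hf j).differentiable (by simp)), h']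
  ring

end Calculus

/-! ## Convexity -/

section Convexity

variable {n : ℕ} {u : E n → ℝ}

theorem add_dotProduct_grad_le (hu : ContDiff ℝ ∞ u) (hc : ∀ x, (hessian u x).PosSemidef)
    (x y : E n) : u x + (y - x).ofLp ⬝ᵥ grad u x ≤ u y := by
  set v := y - x with hv
  set g : ℝ → ℝ := fun t => u (x + t • v) with hg
  have h1 : ∀ t, HasDerivAt g (v.ofLp ⬝ᵥ grad u (x + t • v)) t :=
    hasDerivAt_line_real (hu.differentiable (by simp)) x v
  have hd : deriv g = fun t => v.ofLp ⬝ᵥ grad u (x + t • v) := funext fun t => (h1 t).deriv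
  have h2 : ∀ t, HasDerivAt (deriv g) (v.ofLp ⬝ᵥ (hessian u (x + t • v) *ᵥ v.ofLp)) t := by
    rw [hd]; exact hasDerivAt_line_grad hu x v v
  have hconv : ConvexOn ℝ Set.univ g := by
    refine convexOn_univ_of_deriv2_nonneg (fun t => (h1 t).differentiableAt)
      (fun t => (h2 t).differentiableAt) fun t => ?_
    rw [Function.iterate_succ, Function.iterate_one, Function.comp_apply, (h2 t).deriv]
    simpa using (hc (x + t • v)).dotProduct_mulVec_nonneg v.ofLp
  have h := hconv.le_slope_of_hasDerivAt (Set.mem_univ 0) (Set.mem_univ 1) one_pos (h1 0)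
  simp only [slope_def_field, hg] at h
  simp only [zero_smul, add_zero, one_smul, sub_zero, div_one] at h
  rw [show x + v = y by simp [hv]] at h
  linarith

theorem convexOn_of_posSemidef (hu : ContDiff ℝ ∞ u) (hc : ∀ x, (hessian u x).PosSemidef) :
    ConvexOn ℝ Set.univ u := by
  refine ⟨convex_univ, fun x _ y _ a b ha hb hab => ?_⟩
  have h1 := mul_le_mul_of_nonneg_left (add_dotProduct_grad_le hu hc (a • x + b • y) x) ha
  have h2 := mul_le_mul_of_nonneg_left (add_dotProduct_grad_le hu hc (a • x + b • y) y) hb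
  set m := a • x + b • y with hm
  have h3 : a * ((x - m).ofLp ⬝ᵥ grad u m) + b * ((y - m).ofLp ⬝ᵥ grad u m) = 0 := by
    rw [← smul_eq_mul, ← smul_eq_mul, ← smul_dotProduct, ← smul_dotProduct, ← add_dotProduct]
    have h : a • (x - m) + b • (y - m) = 0 := by
      rw [smul_sub, smul_sub, sub_add_sub_comm, ← hm, ← add_smul, hab, one_smul, sub_self]
    have h' : a • (x - m).ofLp + b • (y - m).ofLp = 0 := congrArg WithLp.ofLp h
    rw [h', zero_dotProduct]
  rw [smul_eq_mul, smul_eq_mul]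
  have h4 : (a + b) * u m = u m := by rw [hab, one_mul]
  linarith

end Convexity

/-! ## The phase function -/

section Phase

variable {n : ℕ} {u : E n → ℝ}

theorem partialDeriv_const_mul {f : E n → ℝ} (hf : Differentiable ℝ f) (c : ℝ) (i : Fin n)
    (x : E n) : partialDeriv i (fun y => c * f y) x = c * partialDeriv i f x := by
  simp [partialDeriv, fderiv_const_mul (hf x)]

theorem partialDeriv_sub {f g : E n → ℝ} (hf : Differentiable ℝ f) (hg : Differentiable ℝ g)
    (i : Fin n) (x : E n) :
    partialDeriv i (fun y => f y - g y) x = partialDeriv i f x - partialDeriv i g x := by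
  simp [partialDeriv, fderiv_fun_sub (hf x) (hg x)]

theorem partialDeriv_sum_coord_mul {F : Fin n → E n → ℝ} (hF : ∀ k, Differentiable ℝ (F k))
    (i : Fin n) (x : E n) :
    partialDeriv i (fun y : E n => ∑ k, y k * F k y) x
      = F i x + ∑ k, x k * partialDeriv i (F k) x := by
  have hc : ∀ k : Fin n, Differentiable ℝ fun y : E n => y k := fun k => by fun_prop
  have hp : ∀ k, partialDeriv i (fun y : E n => y k) x = if k = i then 1 else 0 := by
    intro k
    have h : HasFDerivAt (fun y : E n => y k) (EuclideanSpace.proj k : E n →L[ℝ] ℝ) x :=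
      (EuclideanSpace.proj k : E n →L[ℝ] ℝ).hasFDerivAt
    rw [partialDeriv, h.fderiv]
    simp [e]
  have hs : partialDeriv i (fun y : E n => ∑ k, y k * F k y) x
      = ∑ k, partialDeriv i (fun y : E n => y k * F k y) x := by
    simp only [partialDeriv]
    rw [fderiv_fun_sum fun k _ => ((hc k).fun_mul (hF k)) x]
    simp
  rw [hs]
  simp_rw [partialDeriv_mul (hc _) (hF _), hp]
  simp [Finset.sum_add_distrib, add_comm]

/-- The function `½ x · Du - u`, which equals `log det D²u` for a solution `u`. -/
def phase (u : E n → ℝ) (x : E n) : ℝ := (1 / 2 : ℝ) * (x.ofLp ⬝ᵥ grad u x) - u x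

theorem contDiff_dotProduct_grad (hu : ContDiff ℝ ∞ u) :
    ContDiff ℝ ∞ fun x : E n => x.ofLp ⬝ᵥ grad u x := by
  simp only [dotProduct, grad]
  exact ContDiff.sum fun i _ => ContDiff.mul (by fun_prop) (contDiff_partialDeriv hu i)

theorem contDiff_phase (hu : ContDiff ℝ ∞ u) : ContDiff ℝ ∞ (phase u) :=
  (contDiff_const.mul (contDiff_dotProduct_grad hu)).sub hu

theorem partialDeriv_phase (hu : ContDiff ℝ ∞ u) (j : Fin n) (x : E n) :
    partialDeriv j (phase u) x
      = (1 / 2 : ℝ) * ((∑ k, x k * partialDeriv j (partialDeriv k u) x) - partialDeriv j u x) := by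
  have h1 := partialDeriv_sum_coord_mul
    (fun k => (contDiff_partialDeriv hu k).differentiable (by simp)) j x
  have h2 := (contDiff_dotProduct_grad hu).differentiable (by simp)
  have h3 := partialDeriv_sub (h2.const_mul (1 / 2 : ℝ)) (hu.differentiable (by simp)) j x
  rw [partialDeriv_const_mul h2] at h3
  refine h3.trans ?_
  simp only [dotProduct, grad]
  rw [h1]
  ring

theorem grad_phase (hu : ContDiff ℝ ∞ u) (x : E n) :
    grad (phase u) x = (1 / 2 : ℝ) • (hessian u x *ᵥ x.ofLp - grad u x) := by
  ext j
  simp only [grad, Pi.smul_apply, Pi.sub_apply, smul_eq_mul, partialDeriv_phase hu, mulVec,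
    dotProduct, hessian, of_apply]
  congr 2
  exact Finset.sum_congr rfl fun k _ => mul_comm _ _

/-- The derivative of the Hessian matrix of `u` in the direction `v`. -/
def hessianDeriv (u : E n → ℝ) (x : E n) (v : Fin n → ℝ) : Matrix (Fin n) (Fin n) ℝ :=
  Matrix.of fun i j => ∑ k, v k * partialDeriv k (fun y => hessian u y i j) x

theorem hasDerivAt_hessian_line (hu : ContDiff ℝ ∞ u) (x v : E n) (t : ℝ) (i j : Fin n) :
    HasDerivAt (fun t : ℝ => hessian u (x + t • v) i j)
      (hessianDeriv u (x + t • v) v.ofLp i j) t := by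
  simpa [hessianDeriv] using
    hasDerivAt_line ((contDiff_hessian hu i j).differentiable (by simp)) x v t

/-- Differentiating ½(∑ₖ xₖ ∂ⱼ∂ₖu − ∂ⱼu) once more, the term from differentiating xₖ cancels the
last one, leaving only third derivatives in the radial direction. -/
theorem hessian_phase (hu : ContDiff ℝ ∞ u) (x : E n) :
    hessian (phase u) x = (1 / 2 : ℝ) • hessianDeriv u x x.ofLp := by
  ext i j
  have hd : ∀ k, ContDiff ℝ ∞ fun y => partialDeriv j (partialDeriv k u) y := fun k =>
    contDiff_partialDeriv (contDiff_partialDeriv hu k) j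
  have h1 := partialDeriv_sum_coord_mul (fun k => (hd k).differentiable (by simp)) i x
  have h2 : partialDeriv j (phase u) = fun y => (1 / 2 : ℝ) *
      ((∑ k, y k * partialDeriv j (partialDeriv k u) y) - partialDeriv j u y) :=
    funext fun y => partialDeriv_phase hu j y
  have h3 : Differentiable ℝ fun y : E n => ∑ k, y k * partialDeriv j (partialDeriv k u) y :=
    Differentiable.fun_sum fun k _ =>
      Differentiable.fun_mul (by fun_prop) ((hd k).differentiable (by simp))
  have h4 := (contDiff_partialDeriv hu j).differentiable (by simp)
  have h5 : partialDeriv i (fun y : E n => (1 / 2 : ℝ) *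
      ((∑ k, y k * partialDeriv j (partialDeriv k u) y) - partialDeriv j u y)) x
      = (1 / 2 : ℝ) * (partialDeriv i (fun y : E n => ∑ k, y k * partialDeriv j (partialDeriv k u) y)
        x - partialDeriv i (partialDeriv j u) x) := by
    rw [partialDeriv_const_mul (h3.fun_sub h4), partialDeriv_sub h3 h4]
  simp only [hessian, of_apply, Matrix.smul_apply, smul_eq_mul, hessianDeriv]
  rw [h2, h5, h1, partialDeriv_comm hu j i, add_sub_cancel_left]
  congr 1
  refine Finset.sum_congr rfl fun k _ => ?_
  rw [show (fun y => partialDeriv j (partialDeriv k u) y) = partialDeriv k (partialDeriv j u) from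
    funext fun y => partialDeriv_comm hu j k y, partialDeriv_comm (contDiff_partialDeriv hu j)]

/-- Jacobi's formula along a line. Keeping ψ general serves both a solution, with ψ its phase, and
the potential of a graph, with ψ the log-determinant itself. -/
theorem dotProduct_grad_log_det (hu : ContDiff ℝ ∞ u) (hc : ∀ x, (hessian u x).PosDef)
    {ψ : E n → ℝ} (hψ : Differentiable ℝ ψ) (h : ∀ x, Real.log (hessian u x).det = ψ x)
    (x v : E n) :
    v.ofLp ⬝ᵥ grad ψ x = ((hessian u x)⁻¹ * hessianDeriv u x v.ofLp).trace := by
  have h1 := hasDerivAt_line_real hψ x v 0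
  simp_rw [← h] at h1
  have h2 := deriv_log_det (fun t => hc (x + t • v))
    (fun i j => hasDerivAt_hessian_line hu x v 0 i j) h1
  simpa using h2

end Phase

section Solution

variable {n : ℕ} {u : E n → ℝ}

theorem IsEntireConvexSolution.log_det_eq (hu : IsEntireConvexSolution u) (x : E n) :
    Real.log (hessian u x).det = phase u x := by
  rw [hu.eqn, inner_gradient_eq, phase]

/-- The phase is harmonic for the drift Laplacian. -/
theorem IsEntireConvexSolution.trace_hessian_phase (hu : IsEntireConvexSolution u) (x : E n) :
    ((hessian u x)⁻¹ * hessian (phase u) x).trace = (1 / 2 : ℝ) * (x.ofLp ⬝ᵥ grad (phase u) x) := by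
  rw [hessian_phase hu.smooth, dotProduct_grad_log_det hu.smooth hu.convex
    ((contDiff_phase hu.smooth).differentiable (by simp)) hu.log_det_eq, Matrix.mul_smul,
    Matrix.trace_smul, smul_eq_mul]

end Solution

/-! ## Quadratic functions -/

section Quadratic

variable {n : ℕ}

/-- The quadratic function `⟨x - y, B (x - y)⟩`. -/
def quadratic (B : Matrix (Fin n) (Fin n) ℝ) (y x : E n) : ℝ :=
  (x - y).ofLp ⬝ᵥ (B *ᵥ (x - y).ofLp)

theorem contDiff_quadratic (B : Matrix (Fin n) (Fin n) ℝ) (y : E n) :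
    ContDiff ℝ ∞ (quadratic B y) := by
  unfold quadratic
  simp only [dotProduct, mulVec, PiLp.sub_apply]
  fun_prop

theorem hasFDerivAt_coord (k : Fin n) (x : E n) :
    HasFDerivAt (fun y : E n => y k) (EuclideanSpace.proj k : E n →L[ℝ] ℝ) x :=
  (EuclideanSpace.proj k : E n →L[ℝ] ℝ).hasFDerivAt

theorem partialDeriv_coord_sub (y x : E n) (i k : Fin n) :
    partialDeriv i (fun x : E n => x k - y k) x = (1 : Matrix (Fin n) (Fin n) ℝ) k i := by
  rw [partialDeriv, ((hasFDerivAt_coord k x).sub_const _).fderiv]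
  simp [e, one_apply]

theorem partialDeriv_mulVec_sub (B : Matrix (Fin n) (Fin n) ℝ) (y x : E n) (i k : Fin n) :
    partialDeriv i (fun x : E n => (B *ᵥ (x - y).ofLp) k) x = B k i := by
  simp only [mulVec, dotProduct, PiLp.sub_apply]
  rw [partialDeriv, (HasFDerivAt.fun_sum fun l _ =>
    ((hasFDerivAt_coord l x).sub_const (y l)).const_mul (B k l)).fderiv]
  simp [e]

theorem differentiable_mulVec_sub (B : Matrix (Fin n) (Fin n) ℝ) (y : E n) (k : Fin n) :
    Differentiable ℝ fun x : E n => (B *ᵥ (x - y).ofLp) k := by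
  simp only [mulVec, dotProduct, PiLp.sub_apply]
  fun_prop

theorem partialDeriv_quadratic {B : Matrix (Fin n) (Fin n) ℝ} (hB : B.IsHermitian) (y x : E n)
    (i : Fin n) : partialDeriv i (quadratic B y) x = 2 * (B *ᵥ (x - y).ofLp) i := by
  have h1 : ∀ k, Differentiable ℝ fun x : E n => x k - y k := fun k => by fun_prop
  have h2 : partialDeriv i (quadratic B y) x
      = ∑ k, partialDeriv i (fun x : E n => (x k - y k) * (B *ᵥ (x - y).ofLp) k) x := by
    unfold quadratic
    simp only [dotProduct, partialDeriv, PiLp.sub_apply]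
    rw [fderiv_fun_sum fun k _ => ((h1 k).fun_mul (differentiable_mulVec_sub B y k)) x]
    simp
  rw [h2]
  simp_rw [partialDeriv_mul (h1 _) (differentiable_mulVec_sub B y _), partialDeriv_mulVec_sub,
    partialDeriv_coord_sub]
  rw [Finset.sum_add_distrib, two_mul]
  congr 1
  · simp only [mulVec, dotProduct]
    refine Finset.sum_congr rfl fun k _ => ?_
    rw [← hB.apply i k, star_trivial, mul_comm, PiLp.sub_apply]
  · simp [one_apply]

theorem grad_quadratic {B : Matrix (Fin n) (Fin n) ℝ} (hB : B.IsHermitian) (y x : E n) :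
    grad (quadratic B y) x = (2 : ℝ) • (B *ᵥ (x - y).ofLp) :=
  funext fun i => partialDeriv_quadratic hB y x i

theorem hessian_quadratic {B : Matrix (Fin n) (Fin n) ℝ} (hB : B.IsHermitian) (y x : E n) :
    hessian (quadratic B y) x = (2 : ℝ) • B := by
  ext i j
  simp only [hessian, of_apply, Matrix.smul_apply, smul_eq_mul]
  rw [show partialDeriv j (quadratic B y) = fun x => 2 * (B *ᵥ (x - y).ofLp) j from
    funext fun x => partialDeriv_quadratic hB y x j,
    partialDeriv_const_mul (differentiable_mulVec_sub B y j), partialDeriv_mulVec_sub,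
    ← hB.apply i j, star_trivial]

end Quadratic

/-! ## Properness of solutions -/

section Properness

variable {n : ℕ} {u : E n → ℝ}

/-- The arithmetic of `exists_touching`. Combining `h2` and `h3` gives 2ρ² − 4ρ + 1 ≥ 0, hence ρ ≤ 1
− 1/√2 < 3/10; then `h1` and `h4` give S − U ≥ N(1 − 2ρ − 2ρ²) − K, and the bracket is at least 1/5.
-/
theorem touching_inequality {N K U S ρ : ℝ} (hN : 0 < N) (hρ : 0 ≤ ρ) (hρ1 : ρ ≤ 1)
    (h1 : U - 4 * N * ρ ^ 2 ≤ K - N) (h2 : U + 4 * N * (ρ - ρ ^ 2) ≤ K)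
    (h3 : K - N ≤ U - 2 * N * ρ ^ 2) (h4 : 2 * N * (ρ ^ 2 - ρ) ≤ S) :
    N / 5 - K ≤ S - U := by
  have h5 : 0 ≤ N * (2 * ρ ^ 2 - 4 * ρ + 1) := by nlinarith
  have h6 : 0 ≤ 2 * ρ ^ 2 - 4 * ρ + 1 := nonneg_of_mul_nonneg_right h5 hN
  have h7 : ρ ≤ 3 / 10 := by nlinarith
  have h8 : 2 * ρ ^ 2 + 2 * ρ ≤ 4 / 5 := by nlinarith
  nlinarith [mul_le_mul_of_nonneg_left h8 hN.le]

/-- One side of Cauchy–Schwarz for the form B, read off from its value at v + ρw. When ρ = 0 that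
expansion says nothing, and semidefiniteness gives Bv = 0 instead. -/
theorem neg_le_dotProduct_mulVec {B : Matrix (Fin n) (Fin n) ℝ} (hB : B.PosSemidef)
    {v w : Fin n → ℝ} {ρ : ℝ} (hρ : 0 ≤ ρ) (hv : v ⬝ᵥ (B *ᵥ v) = ρ ^ 2)
    (hw : w ⬝ᵥ (B *ᵥ w) = 1) : -ρ ≤ w ⬝ᵥ (B *ᵥ v) := by
  have hsymm : v ⬝ᵥ (B *ᵥ w) = w ⬝ᵥ (B *ᵥ v) := by
    rw [dotProduct_mulVec, ← mulVec_transpose, dotProduct_comm]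
    congr 2
    simpa [conjTranspose_eq_transpose_of_trivial] using hB.isHermitian.eq
  rcases hρ.eq_or_lt with rfl | hpos
  · have h : star v ⬝ᵥ (B *ᵥ v) = 0 := by simpa using hv
    rw [hB.dotProduct_mulVec_zero_iff] at h
    simp [h]
  · have h := hB.dotProduct_mulVec_nonneg (v + ρ • w)
    rw [star_trivial, mulVec_add, mulVec_smul, add_dotProduct, dotProduct_add, dotProduct_add,
      smul_dotProduct, smul_dotProduct, dotProduct_smul, dotProduct_smul, hv, hw, hsymm] at h
    simp only [smul_eq_mul] at h
    nlinarith

/-- Touching a convex function from above by a quadratic function on an ellipsoid whose boundary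
passes through the origin. -/
theorem exists_touching (hu : ContDiff ℝ ∞ u) (hc : ∀ x, (hessian u x).PosSemidef)
    {B : Matrix (Fin n) (Fin n) ℝ} (hB : B.PosSemidef) {w : E n}
    (hw : w.ofLp ⬝ᵥ (B *ᵥ w.ofLp) = 1) (hcpt : IsCompact {x | quadratic B w x ≤ 1}) {K N : ℝ}
    (hK : ∀ x, quadratic B w x ≤ 1 → u x ≤ K) (hN : 0 < N) (huw : u w = K - N) :
    ∃ x, ((4 * N) • B - hessian u x).PosSemidef ∧ N / 5 - K ≤ phase u x := by
  set q := quadratic B w with hq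
  have hqc : ContDiff ℝ ∞ q := contDiff_quadratic B w
  have hqw : q w = 0 := by simp [hq, quadratic]
  have hFc : ContDiff ℝ ∞ fun x => 2 * N * q x + -1 * u x :=
    (contDiff_const.mul hqc).add (contDiff_const.mul hu)
  obtain ⟨x₀, hx₀, hmin⟩ := hcpt.exists_isMinOn ⟨w, by simp [hqw]⟩ hFc.continuous.continuousOn
  have hle : 2 * N * q x₀ + -1 * u x₀ ≤ 2 * N * q w + -1 * u w := hmin (by simp [hqw])
  -- The coefficient 2N exceeds the depth N of u at the centre, so 2Nq − u is larger on the boundary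
  -- of the ellipsoid than at w, and its minimum is interior.
  have hlt : q x₀ < 1 := by
    have hx₀' : q x₀ ≤ 1 := hx₀
    by_contra! h
    have h1 := hK x₀ hx₀'
    rw [hqw] at hle
    nlinarith
  have hloc : IsLocalMin (fun x => 2 * N * q x + -1 * u x) x₀ := by
    have hopen : {x | q x < 1} ∈ 𝓝 x₀ :=
      (isOpen_lt hqc.continuous continuous_const).mem_nhds hlt
    filter_upwards [hopen] with x hx using hmin (le_of_lt hx)
  have hid : ∀ c t : ℝ, HasDerivAt (fun s => c * s) c t := fun c t => by
    simpa using (hasDerivAt_id t).const_mul c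
  have hid' : ∀ c t : ℝ, HasDerivAt (fun _ : ℝ => c) 0 t := fun c t => hasDerivAt_const t c
  have hg := grad_eq_zero_of_isLocalMin hloc
  have hH := posSemidef_of_isLocalMin hFc hloc
  have hqd := hqc.differentiable (by simp)
  have hud := hu.differentiable (by simp)
  rw [grad_add (hqd.const_mul _) (hud.const_mul _), grad_comp (hid _) hqd, grad_comp (hid _) hud,
    grad_quadratic hB.isHermitian] at hg
  rw [hessian_add (contDiff_const.mul hqc) (contDiff_const.mul hu),
    hessian_comp (hid _) (hid' _) hqc, hessian_comp (hid _) (hid' _) hu,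
    hessian_quadratic hB.isHermitian] at hH
  set v := x₀ - w with hv
  have hgrad : grad u x₀ = (4 * N) • (B *ᵥ v.ofLp) := by
    have h : grad u x₀ = (2 * N) • (2 : ℝ) • (B *ᵥ v.ofLp) := by
      rw [neg_one_smul, add_neg_eq_zero] at hg
      exact hg.symm
    rw [h, smul_smul]; ring_nf
  refine ⟨x₀, ?_, ?_⟩
  · convert hH using 1
    rw [zero_smul, add_zero, zero_smul, add_zero, smul_smul, neg_one_smul, sub_eq_add_neg]
    ring_nf
  have hq0 : 0 ≤ q x₀ := by simpa [hq, quadratic] using hB.dotProduct_mulVec_nonneg (x₀ - w).ofLp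
  set ρ := Real.sqrt (q x₀) with hρ
  have hρ0 : 0 ≤ ρ := Real.sqrt_nonneg _
  have hρ2 : ρ ^ 2 = q x₀ := Real.sq_sqrt hq0
  have hρ1 : ρ ≤ 1 := Real.sqrt_le_iff.mpr ⟨zero_le_one, by simpa using hlt.le⟩
  have hvv : v.ofLp ⬝ᵥ (B *ᵥ v.ofLp) = ρ ^ 2 := by rw [hρ2]; rfl
  have hvw := neg_le_dotProduct_mulVec hB hρ0 hvv hw
  have hdual : ∀ a : E n, a.ofLp ⬝ᵥ grad u x₀ = 4 * N * (a.ofLp ⬝ᵥ (B *ᵥ v.ofLp)) := fun a => by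
    rw [hgrad, dotProduct_smul, smul_eq_mul]
  -- The four inputs are the tangent plane at x₀ evaluated at the centre w, the same plane at the
  -- boundary point w + v/ρ beyond x₀, minimality against w, and Cauchy–Schwarz, which uses that the
  -- origin lies on the boundary.
  refine touching_inequality hN hρ0 hρ1 ?_ ?_ ?_ ?_ (U := u x₀)
  · have h := add_dotProduct_grad_le hu hc x₀ w
    rw [hdual, show (w - x₀).ofLp = -v.ofLp by simp [hv], neg_dotProduct, hvv, huw] at h
    linarith
  · rcases hρ0.eq_or_lt with h0 | hpos
    · have h := hK x₀ hlt.le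
      rw [← h0]; linarith
    · have h := add_dotProduct_grad_le hu hc x₀ (w + ρ⁻¹ • v)
      have h1 : u (w + ρ⁻¹ • v) ≤ K := by
        refine hK _ ?_
        simp only [hq, quadratic, add_sub_cancel_left, WithLp.ofLp_smul, mulVec_smul,
          smul_dotProduct, dotProduct_smul, hvv, smul_eq_mul]
        apply le_of_eq
        field_simp
      rw [hdual, show (w + ρ⁻¹ • v - x₀) = (ρ⁻¹ - 1) • v by rw [sub_smul, one_smul, hv]; abel,
        WithLp.ofLp_smul, smul_dotProduct, hvv, smul_eq_mul] at h
      have h2 : (ρ⁻¹ - 1) * ρ ^ 2 = ρ - ρ ^ 2 := by field_simp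
      rw [h2] at h
      linarith
  · rw [hρ2]
    rw [hqw] at hle
    linarith
  · rw [hdual, show x₀.ofLp = w.ofLp + v.ofLp by simp [hv], add_dotProduct, hvv]
    nlinarith

end Properness

/-! ### A long thin ellipsoid with explicit determinant -/

section Ellipsoid

variable {n : ℕ}

/-- The matrix of the quadratic form `4 |v - a w|² + a²`, where `a = w · v / |w|²`. -/
def ellipsoidMatrix (w : Fin n → ℝ) : Matrix (Fin n) (Fin n) ℝ :=
  (4 : ℝ) • (1 + vecMulVec (-((1 - 1 / (4 * (w ⬝ᵥ w))) / (w ⬝ᵥ w)) • w) w)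

theorem dotProduct_ellipsoidMatrix_mulVec {w : Fin n → ℝ} (hw : 0 < w ⬝ᵥ w) (v : Fin n → ℝ) :
    v ⬝ᵥ (ellipsoidMatrix w *ᵥ v)
      = 4 * ((v - ((w ⬝ᵥ v) / (w ⬝ᵥ w)) • w) ⬝ᵥ (v - ((w ⬝ᵥ v) / (w ⬝ᵥ w)) • w))
        + ((w ⬝ᵥ v) / (w ⬝ᵥ w)) ^ 2 := by
  simp only [ellipsoidMatrix, smul_mulVec, add_mulVec, one_mulVec, vecMulVec_mulVec,
    dotProduct_smul, dotProduct_add, sub_dotProduct, dotProduct_sub, smul_dotProduct, smul_eq_mul,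
    neg_smul, dotProduct_neg, op_smul_eq_smul, dotProduct_comm v w]
  field_simp
  ring

theorem ellipsoidMatrix_posSemidef {w : Fin n → ℝ} (hw : 0 < w ⬝ᵥ w) :
    (ellipsoidMatrix w).PosSemidef := by
  refine PosSemidef.of_dotProduct_mulVec_nonneg ?_ fun v => ?_
  · ext i j
    simp only [ellipsoidMatrix, conjTranspose_apply, star_trivial, Matrix.smul_apply,
      Matrix.add_apply, one_apply, vecMulVec_apply, Pi.smul_apply, smul_eq_mul, eq_comm (a := i)]
    ring
  · rw [star_trivial, dotProduct_ellipsoidMatrix_mulVec hw]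
    have h := dotProduct_self_star_nonneg (v - ((w ⬝ᵥ v) / (w ⬝ᵥ w)) • w)
    rw [star_trivial] at h
    positivity

/-- The matrix is 4 times a rank-one perturbation of the identity, so the matrix determinant lemma
applies. The decay in |w| comes from the single long semi-axis, of length |w|. -/
theorem det_ellipsoidMatrix {w : Fin n → ℝ} (hw : 0 < w ⬝ᵥ w) :
    (ellipsoidMatrix w).det = 4 ^ n / (4 * (w ⬝ᵥ w)) := by
  rw [ellipsoidMatrix, det_smul, Fintype.card_fin, vecMulVec_eq Unit,
    det_one_add_replicateCol_mul_replicateRow, dotProduct_smul, smul_eq_mul]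
  field_simp
  ring

end Ellipsoid

/-! ### Bounded sublevel sets -/

section Properness

variable {n : ℕ} {u : E n → ℝ}

theorem norm_sq_eq_dotProduct (x : E n) : ‖x‖ ^ 2 = x.ofLp ⬝ᵥ x.ofLp := by
  rw [EuclideanSpace.real_norm_sq_eq, dotProduct]
  exact Finset.sum_congr rfl fun i _ => sq _

/-- The ellipsoid around `w` lies in the convex hull of the unit ball and `4w`. -/
theorem exists_combination_of_quadratic_le_one {w x : E n} (hw : 0 < w.ofLp ⬝ᵥ w.ofLp)
    (hx : quadratic (ellipsoidMatrix w.ofLp) w x ≤ 1) :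
    ∃ s : ℝ, 0 ≤ s ∧ s ≤ 1 ∧ ∃ p : E n, ‖p‖ ≤ 1 ∧ x = (1 - s) • p + s • (4 : ℝ) • w := by
  rw [quadratic, dotProduct_ellipsoidMatrix_mulVec hw] at hx
  set v := x - w with hv
  set a := (w.ofLp ⬝ᵥ v.ofLp) / (w.ofLp ⬝ᵥ w.ofLp) with ha
  have hr : ((v.ofLp - a • w.ofLp) ⬝ᵥ (v.ofLp - a • w.ofLp)) = ‖v - a • w‖ ^ 2 := by
    rw [norm_sq_eq_dotProduct]; rfl
  rw [hr] at hx
  have ha1 : |a| ≤ 1 := by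
    rw [← sq_le_one_iff_abs_le_one]; nlinarith [sq_nonneg ‖v - a • w‖]
  obtain ⟨ha2, ha3⟩ := abs_le.mp ha1
  have hr1 : ‖v - a • w‖ ≤ 1 / 2 := by nlinarith [norm_nonneg (v - a • w), sq_nonneg a]
  have hs : 1 / 2 ≤ 1 - (1 + a) / 4 := by linarith
  have hs0 : (1 - (1 + a) / 4) ≠ 0 := by linarith
  -- Here x = (1 + a)w + (v − aw). The first term is the fraction (1 + a)/4 of 4w; the second has
  -- norm at most 1/2, which is at most the remaining weight because a ≤ 1.
  refine ⟨(1 + a) / 4, by linarith, by linarith, (1 - (1 + a) / 4)⁻¹ • (v - a • w), ?_, ?_⟩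
  · rw [norm_smul, norm_inv, Real.norm_of_nonneg (by linarith), inv_mul_le_iff₀ (by linarith)]
    linarith
  · rw [smul_inv_smul₀ hs0, smul_smul, hv]
    module

theorem isCompact_ellipsoid {w : E n} (hw : 0 < w.ofLp ⬝ᵥ w.ofLp) :
    IsCompact {x | quadratic (ellipsoidMatrix w.ofLp) w x ≤ 1} := by
  refine Metric.isCompact_of_isClosed_isBounded
    (isClosed_le (contDiff_quadratic _ _).continuous continuous_const) ?_
  refine (Metric.isBounded_closedBall (x := (0 : E n)) (r := 1 + ‖(4 : ℝ) • w‖)).subset ?_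
  intro x hx
  obtain ⟨s, hs0, hs1, p, hp, rfl⟩ := exists_combination_of_quadratic_le_one hw hx
  rw [mem_closedBall_zero_iff]
  refine (norm_add_le _ _).trans ?_
  rw [norm_smul, norm_smul, Real.norm_of_nonneg hs0, Real.norm_of_nonneg (sub_nonneg.mpr hs1)]
  have h1 := norm_nonneg p
  have h2 := norm_nonneg ((4 : ℝ) • w)
  nlinarith

/-- The sublevel sets of an entire convex solution are bounded. -/
theorem IsEntireConvexSolution.exists_norm_le (hu : IsEntireConvexSolution u) (K : ℝ) :
    ∃ R : ℝ, ∀ x, u x ≤ K → ‖x‖ ≤ R := by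
  obtain ⟨M, hM⟩ := (isCompact_closedBall (0 : E n) 1).bddAbove_image
    (hu.smooth.continuous.continuousOn)
  have hM' : ∀ x : E n, ‖x‖ ≤ 1 → u x ≤ M := fun x hx =>
    hM ⟨x, by simpa using hx, rfl⟩
  -- The extra 1 guarantees N = K' − u(w) ≥ 1 below.
  set K' := max M K + 1 with hK'
  set C := K' + n * Real.log (80 * (n + 1)) with hC
  refine ⟨max 4 (4 * Real.exp C), fun X hX => ?_⟩
  by_contra! hlt
  obtain ⟨hX4, hXC⟩ := max_lt_iff.mp hlt
  set w : E n := (4 : ℝ)⁻¹ • X with hw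
  have hXw : (4 : ℝ) • w = X := by rw [hw, smul_inv_smul₀ (by norm_num)]
  have hww : 16 * (w.ofLp ⬝ᵥ w.ofLp) = ‖X‖ ^ 2 := by
    have h : ‖X‖ = 4 * ‖w‖ := by
      conv_lhs => rw [← hXw, norm_smul, Real.norm_of_nonneg (by norm_num)]
    rw [← norm_sq_eq_dotProduct, h]
    ring
  have hd : 0 < w.ofLp ⬝ᵥ w.ofLp := by nlinarith
  have hconv := convexOn_of_posSemidef hu.smooth fun x => (hu.convex x).posSemidef
  have hbound : ∀ x, quadratic (ellipsoidMatrix w.ofLp) w x ≤ 1 → u x ≤ K' - 1 := by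
    intro x hx
    obtain ⟨s, hs0, hs1, p, hp, rfl⟩ := exists_combination_of_quadratic_le_one hd hx
    rw [hXw]
    have h := hconv.2 (Set.mem_univ p) (Set.mem_univ X) (sub_nonneg.mpr hs1) hs0
      (sub_add_cancel 1 s)
    rw [smul_eq_mul, smul_eq_mul] at h
    have h1 := mul_le_mul_of_nonneg_left ((hM' p hp).trans (le_max_left M K)) (sub_nonneg.mpr hs1)
    have h2 := mul_le_mul_of_nonneg_left (hX.trans (le_max_right M K)) hs0
    rw [hK', add_sub_cancel_right]
    linarith
  set N := K' - u w with hN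
  have hN1 : 1 ≤ N := by
    have h := hbound w (by simp [quadratic])
    linarith
  have hN0 : 0 < N := by linarith
  have hBw : w.ofLp ⬝ᵥ (ellipsoidMatrix w.ofLp *ᵥ w.ofLp) = 1 := by
    rw [dotProduct_ellipsoidMatrix_mulVec hd, div_self hd.ne']
    simp
  obtain ⟨x, hx1, hx2⟩ := exists_touching hu.smooth (fun x => (hu.convex x).posSemidef)
    (ellipsoidMatrix_posSemidef hd) hBw (isCompact_ellipsoid hd)
    (fun x hx => (hbound x hx).trans (by linarith)) hN0 (by rw [hN]; ring : u w = K' - N)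
  have hpos : ((4 * N) • ellipsoidMatrix w.ofLp).PosDef := by
    have h := (hu.convex x).add_posSemidef hx1
    rwa [add_sub_cancel] at h
  have h1 := log_det_mono (hu.convex x) hpos hx1
  rw [hu.log_det_eq, det_smul, Fintype.card_fin, det_ellipsoidMatrix hd,
    show (4 * N) ^ n * (4 ^ n / (4 * (w.ofLp ⬝ᵥ w.ofLp)))
      = (16 * N) ^ n / (4 * (w.ofLp ⬝ᵥ w.ofLp)) by rw [← mul_div_assoc, ← mul_pow]; ring_nf,
    Real.log_div (by positivity) (by positivity), Real.log_pow] at h1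
  have hn : (0 : ℝ) < n + 1 := by positivity
  -- The split is chosen so that n log(16N) is at most a constant plus N/5, which the lower bound
  -- N/5 − K' for the phase absorbs; only |w| remains to be bounded.
  have h2 : Real.log (16 * N) ≤ Real.log (80 * (n + 1)) + N / (5 * (n + 1)) := by
    rw [show 16 * N = (80 * (n + 1)) * (N / (5 * (n + 1))) by field_simp; ring,
      Real.log_mul (by positivity) (by positivity)]
    linarith [Real.log_le_sub_one_of_pos (show 0 < N / (5 * ((n : ℝ) + 1)) by positivity)]
  have h3 : n * Real.log (16 * N) ≤ n * Real.log (80 * (n + 1)) + N / 5 := by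
    refine (mul_le_mul_of_nonneg_left h2 (Nat.cast_nonneg n)).trans ?_
    rw [mul_add]
    gcongr
    rw [mul_div_assoc', div_le_div_iff₀ (by positivity) (by norm_num)]
    nlinarith
  have h4 : Real.log (4 * (w.ofLp ⬝ᵥ w.ofLp)) ≤ C := by linarith
  rw [Real.log_le_iff_le_exp (by positivity)] at h4
  nlinarith

end Properness

/-! ## The phase attains its maximum -/

section Maximum

variable {n : ℕ} {u : E n → ℝ}

theorem hasDerivAt_const_mul_exp (c a t : ℝ) :
    HasDerivAt (fun s => c * Real.exp (a * s)) (c * a * Real.exp (a * t)) t := by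
  have h : HasDerivAt (fun s => a * s) a t := by simpa using (hasDerivAt_id t).const_mul a
  exact (h.exp.const_mul c).congr_deriv (by ring)

theorem exists_forall_le_of_sublevel_bounded {F : E n → ℝ} (hF : Continuous F) {R : ℝ}
    (hR : ∀ x, F x ≤ F 0 → ‖x‖ ≤ R) : ∃ p, ∀ x, F p ≤ F x := by
  obtain ⟨p, -, hp⟩ := (isCompact_closedBall (0 : E n) R).exists_isMinOn
    ⟨0, by simpa using hR 0 le_rfl⟩ hF.continuousOn
  refine ⟨p, fun x => ?_⟩
  by_cases hx : ‖x‖ ≤ R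
  · exact hp (by simpa using hx)
  · have h0 : F p ≤ F 0 := hp (by simpa using hR 0 le_rfl)
    exact h0.trans (le_of_lt (not_le.mp fun h => hx (hR x h)))

/-- Eliminating s turns the hypothesis into 0 ≤ 4m − 2z + θz with θ = (P + Q)/(P + 2Q) ≤ 1. The
bound on z thus does not depend on P and Q. -/
theorem le_of_trace_inequality {P Q z s m : ℝ} (hP : 0 < P) (hQ : 0 < Q) (hm : 0 ≤ m)
    (hs : (P + 2 * Q) * s = P * z)
    (h : 0 ≤ -(Q * z) / 8 + Q ^ 2 / P * s / 16 + Q * m / 4 + Q * s / 16) : z ≤ 4 * m := by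
  have hPQ : 0 < P + 2 * Q := by positivity
  have hs' : s = P * z / (P + 2 * Q) := by rw [← hs, mul_div_cancel_left₀ _ hPQ.ne']
  rw [hs'] at h
  have h1 : -(Q * z) / 8 + Q ^ 2 / P * (P * z / (P + 2 * Q)) / 16 + Q * m / 4
      + Q * (P * z / (P + 2 * Q)) / 16 = Q / 16 * (4 * m - 2 * z + (P + Q) / (P + 2 * Q) * z) := by
    field_simp
    ring
  rw [h1] at h
  have h2 : 0 ≤ 4 * m - 2 * z + (P + Q) / (P + 2 * Q) * z :=
    nonneg_of_mul_nonneg_right h (by positivity)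
  by_contra! hz
  have h3 : (P + Q) / (P + 2 * Q) ≤ 1 := by rw [div_le_one hPQ]; linarith
  nlinarith

/-- The point p minimizes exp(−φ/4) + δ exp(u/4), which is coercive because u is proper. What
matters is that the bound on u(p) is independent of δ. -/
theorem IsEntireConvexSolution.exists_phase_comparison (hu : IsEntireConvexSolution u) {δ : ℝ}
    (hδ : 0 < δ) : ∃ p, u p ≤ u 0 + 4 * n ∧
      ∀ x, Real.exp (-(1 / 4) * phase u p) ≤
        Real.exp (-(1 / 4) * phase u x) + δ * Real.exp (1 / 4 * u x) := by
  set φ := phase u with hφ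
  have hφc : ContDiff ℝ ∞ φ := contDiff_phase hu.smooth
  have h1c : ContDiff ℝ ∞ fun x => 1 * Real.exp (-(1 / 4) * φ x) :=
    contDiff_const.mul (contDiff_const.mul hφc).exp
  have h2c : ContDiff ℝ ∞ fun x => δ * Real.exp (1 / 4 * u x) :=
    contDiff_const.mul (contDiff_const.mul hu.smooth).exp
  set W : E n → ℝ := fun x => 1 * Real.exp (-(1 / 4) * φ x) + δ * Real.exp (1 / 4 * u x) with hW
  have hWc : ContDiff ℝ ∞ W := h1c.add h2c
  obtain ⟨R, hR⟩ := hu.exists_norm_le (4 * Real.log (W 0 / δ))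
  obtain ⟨p, hp⟩ := exists_forall_le_of_sublevel_bounded hWc.continuous (R := R) fun x hx => by
    refine hR x ?_
    have h1 : δ * Real.exp (1 / 4 * u x) ≤ W 0 :=
      le_trans (le_add_of_nonneg_left (by positivity)) hx
    have h2 : Real.exp (1 / 4 * u x) ≤ W 0 / δ := by rwa [le_div_iff₀ hδ, mul_comm]
    have h3 := (Real.le_log_iff_exp_le ((Real.exp_pos _).trans_le h2)).mpr h2
    linarith
  have hloc : IsLocalMin W p := Filter.Eventually.of_forall hp
  have hg := grad_eq_zero_of_isLocalMin hloc
  have hH := posSemidef_of_isLocalMin hWc hloc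
  rw [hW, grad_add (h1c.differentiable (by simp)) (h2c.differentiable (by simp)),
    grad_comp (hasDerivAt_const_mul_exp 1 (-(1 / 4))) (hφc.differentiable (by simp)),
    grad_comp (hasDerivAt_const_mul_exp δ (1 / 4)) (hu.smooth.differentiable (by simp))] at hg
  rw [hW, hessian_add h1c h2c,
    hessian_comp (hasDerivAt_const_mul_exp 1 (-(1 / 4))) (hasDerivAt_const_mul_exp _ _) hφc,
    hessian_comp (hasDerivAt_const_mul_exp δ (1 / 4)) (hasDerivAt_const_mul_exp _ _) hu.smooth] at hH
  set P := Real.exp (-(1 / 4) * φ p) with hP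
  set Q := δ * Real.exp (1 / 4 * u p) with hQ
  have hP0 : 0 < P := Real.exp_pos _
  have hQ0 : 0 < Q := mul_pos hδ (Real.exp_pos _)
  set G := hessian u p with hG
  have hGu : IsUnit G.det := isUnit_iff_ne_zero.mpr (hu.convex p).det_pos.ne'
  set d := grad u p with hd
  have hgφ : grad φ p = (Q / P) • d := by
    have h : (P / 4) • grad φ p = (Q / 4) • d := by
      rw [← sub_eq_zero, ← neg_eq_zero, ← hg]
      module
    rw [show Q / P = (P / 4)⁻¹ * (Q / 4) by field_simp, mul_smul, ← h,
      inv_smul_smul₀ (by positivity)]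
  -- Criticality makes Dφ parallel to Du; inserting Dφ = ½(Gp − Du) shows that G⁻¹Du is a multiple
  -- of p, so every quadratic term in the trace inequality reduces to z = p·Du.
  have hGx : P • (G *ᵥ p.ofLp) = (P + 2 * Q) • d := by
    have h := grad_phase hu.smooth p
    rw [← hφ, hgφ] at h
    have h' : P • (Q / P) • d = P • (1 / 2 : ℝ) • (G *ᵥ p.ofLp - d) := congrArg (P • ·) h
    rw [smul_smul, mul_div_cancel₀ _ hP0.ne'] at h'
    have h'' : (P + 2 * Q) • d = P • d + (2 : ℝ) • (Q • d) := by module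
    rw [h'', h']
    module
  have hinv : (P + 2 * Q) • (G⁻¹ *ᵥ d) = P • p.ofLp := by
    rw [← mulVec_smul, ← hGx, mulVec_smul, mulVec_mulVec, nonsing_inv_mul _ hGu, one_mulVec]
  set z := p.ofLp ⬝ᵥ d with hz
  have hs : (P + 2 * Q) * (d ⬝ᵥ (G⁻¹ *ᵥ d)) = P * z := by
    rw [← smul_eq_mul, ← dotProduct_smul, hinv, dotProduct_smul, smul_eq_mul, dotProduct_comm]
  have htr := trace_mul_nonneg (hu.convex p).inv.posSemidef hH
  have hzn : z ≤ 4 * n := by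
    refine le_of_trace_inequality hP0 hQ0 (Nat.cast_nonneg n) hs (htr.trans_eq ?_)
    simp only [Matrix.mul_add, Matrix.mul_smul, Matrix.trace_add, Matrix.trace_smul,
      trace_mul_vecMulVec, smul_eq_mul]
    rw [hu.trace_hessian_phase, ← hφ, hgφ, ← hG, nonsing_inv_mul _ hGu, Matrix.trace_one,
      Fintype.card_fin, mulVec_smul, dotProduct_smul, dotProduct_smul, smul_dotProduct, ← hz]
    simp only [smul_eq_mul, one_mul]
    rw [show δ * (1 / 4) * Real.exp (1 / 4 * u p) = Q / 4 by rw [hQ]; ring,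
      show δ * (1 / 4) * (1 / 4) * Real.exp (1 / 4 * u p) = Q / 16 by rw [hQ]; ring]
    field_simp
    ring
  refine ⟨p, ?_, fun x => ?_⟩
  -- The tangent plane at p evaluated at the origin gives u(p) ≤ u(0) + z.
  · have h := add_dotProduct_grad_le hu.smooth (fun x => (hu.convex x).posSemidef) p 0
    rw [zero_sub, WithLp.ofLp_neg, neg_dotProduct, ← hd, ← hz] at h
    linarith
  · have h := hp x
    simp only [hW, one_mul] at h
    exact le_trans (le_add_of_nonneg_right hQ0.le) h

/-- The phase of an entire convex solution attains its maximum. -/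
theorem IsEntireConvexSolution.exists_phase_le (hu : IsEntireConvexSolution u) :
    ∃ p, ∀ x, phase u x ≤ phase u p := by
  obtain ⟨R, hR⟩ := hu.exists_norm_le (u 0 + 4 * n)
  have h0 : (0 : E n) ∈ Metric.closedBall (0 : E n) R := by
    simpa using hR 0 (by simp)
  obtain ⟨p, -, hp⟩ := (isCompact_closedBall (0 : E n) R).exists_isMaxOn ⟨0, h0⟩
    (contDiff_phase hu.smooth).continuous.continuousOn
  refine ⟨p, fun x => ?_⟩
  have h : Real.exp (-(1 / 4) * phase u p) ≤ Real.exp (-(1 / 4) * phase u x) := by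
    refine le_of_forall_pos_le_add fun ε hε => ?_
    -- This δ makes the penalty at x exactly ε. It depends on x, but the ball containing q does not.
    obtain ⟨q, hq1, hq2⟩ := hu.exists_phase_comparison
      (show 0 < ε / Real.exp (1 / 4 * u x) by positivity)
    have h1 : phase u q ≤ phase u p := hp (by simpa using hR q hq1)
    have h2 := hq2 x
    rw [div_mul_cancel₀ _ (Real.exp_pos _).ne'] at h2
    refine le_trans (Real.exp_le_exp.mpr ?_) h2
    linarith
  rw [Real.exp_le_exp] at h
  linarith

end Maximum

/-! ## The strong maximum principle -/

section StrongMaximumPrinciple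

variable {n : ℕ}

theorem quadratic_one (y x : E n) : quadratic 1 y x = ‖x - y‖ ^ 2 := by
  rw [quadratic, one_mulVec, norm_sq_eq_dotProduct]

/-- A ball whose closure meets a closed set in exactly one point. -/
theorem exists_touching_ball {K : Set (E n)} (hK : IsClosed K) (hne : K.Nonempty) {z : E n}
    (hz : z ∉ K) : ∃ k ∈ K, ∃ y : E n, y ≠ k ∧ ∀ x ∈ K, ‖x - y‖ ≤ ‖k - y‖ → x = k := by
  obtain ⟨k, hk, hdist⟩ := hK.exists_infDist_eq_dist hne z
  have hzk : k ≠ z := fun h => hz (h ▸ hk)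
  set D := k - z with hD
  have hD0 : D ≠ 0 := sub_ne_zero.mpr hzk
  -- The ball centred at the midpoint of z and its nearest point k lies inside the ball about z
  -- through k and meets its sphere only at k.
  refine ⟨k, hk, z + (1 / 2 : ℝ) • D, ?_, fun x hx hle => ?_⟩
  · intro h
    have h' : (1 / 2 : ℝ) • D = D := by rw [← add_right_inj z, h, hD]; abel
    have h'' : (1 / 2 : ℝ) • D = 0 := by
      have h3 : D - (1 / 2 : ℝ) • D = (1 / 2 : ℝ) • D := by module
      rw [← h3, h', sub_self]
    exact hD0 ((smul_eq_zero.mp h'').resolve_left (by norm_num))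
  · have h1 : ‖D‖ ≤ ‖x - z‖ := by
      have h := Metric.infDist_le_dist_of_mem (x := z) hx
      rw [hdist, dist_comm, dist_comm z x, dist_eq_norm, dist_eq_norm] at h
      exact h
    set X := x - z with hX
    rw [show x - (z + (1 / 2 : ℝ) • D) = X - (1 / 2 : ℝ) • D by rw [hX]; abel,
      show k - (z + (1 / 2 : ℝ) • D) = (1 / 2 : ℝ) • D by
        rw [← sub_sub, ← hD]; module, norm_smul] at hle
    have h2 : ‖X - (1 / 2 : ℝ) • D‖ ^ 2 ≤ (1 / 2 * ‖D‖) ^ 2 := by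
      have h := pow_le_pow_left₀ (norm_nonneg _) hle 2
      rwa [Real.norm_of_nonneg (by norm_num)] at h
    rw [norm_sub_sq_real, norm_smul, inner_smul_right, Real.norm_of_nonneg (by norm_num)] at h2
    have h3 : ‖D‖ ^ 2 ≤ ‖X‖ ^ 2 := pow_le_pow_left₀ (norm_nonneg _) h1 2
    have h4 : ‖X - D‖ ^ 2 ≤ 0 := by
      rw [norm_sub_sq_real]
      nlinarith
    have h5 : X - D = 0 := by
      rw [← norm_eq_zero]
      exact pow_eq_zero_iff (two_ne_zero) |>.mp (le_antisymm h4 (by positivity))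
    rw [hX, hD, sub_sub_sub_cancel_right, sub_eq_zero] at h5
    exact h5

/-- Hopf's argument. Near a point k where a ball touches the maximum set from outside, exp(−α|x −
y|²) is strictly subharmonic for large α. Adding a small multiple of it to φ produces an interior
maximum near k, where the operator would have to be both nonpositive and positive. -/
theorem eq_of_forall_le_of_subharmonic {φ : E n → ℝ} (hφ : ContDiff ℝ ∞ φ)
    {A : E n → Matrix (Fin n) (Fin n) ℝ} {b : E n → Fin n → ℝ} (hA : ∀ x, (A x).PosDef)
    (hAc : Continuous A) (hbc : Continuous b)
    (hL : ∀ x, 0 ≤ (A x * hessian φ x).trace + b x ⬝ᵥ grad φ x) {p : E n}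
    (hp : ∀ x, φ x ≤ φ p) (x : E n) : φ x = φ p := by
  by_contra hx
  obtain ⟨k, hk, y, hyk, huniq⟩ := exists_touching_ball
    (isClosed_eq hφ.continuous continuous_const) ⟨p, rfl⟩ (z := x) (K := {x | φ x = φ p}) hx
  set M := φ p with hM
  have hkM : φ k = M := hk
  have hR : 0 < ‖k - y‖ := norm_pos_iff.mpr (sub_ne_zero.mpr hyk.symm)
  -- Half the radius keeps the centre y out of C, so the form in x − y is positive there and α can
  -- be chosen by compactness.
  set r := ‖k - y‖ / 2 with hr
  have hr0 : 0 < r := by positivity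
  set C := Metric.closedBall k r with hC
  have hCc : IsCompact C := isCompact_closedBall k r
  have hCd : ∀ x ∈ C, (x - y).ofLp ≠ 0 := by
    intro x hx h0
    have h1 : x = y := sub_eq_zero.mp ((WithLp.ofLp_eq_zero 2).mp h0)
    rw [h1, hC, Metric.mem_closedBall, dist_comm, dist_eq_norm] at hx
    linarith
  have hpos : ∀ x ∈ C, 0 < (x - y).ofLp ⬝ᵥ (A x *ᵥ (x - y).ofLp) := fun x hx => by
    simpa using (hA x).dotProduct_mulVec_pos (hCd x hx)
  have hdc : Continuous fun x : E n => (x - y).ofLp := by fun_prop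
  obtain ⟨α₀, hα₀⟩ := hCc.bddAbove_image (f := fun x =>
    ((A x).trace + b x ⬝ᵥ (x - y).ofLp) / (2 * ((x - y).ofLp ⬝ᵥ (A x *ᵥ (x - y).ofLp)))) (by
      refine ContinuousOn.div ?_ ?_ fun x hx => (mul_pos two_pos (hpos x hx)).ne'
      · exact (hAc.matrix_trace.add (hbc.dotProduct hdc)).continuousOn
      · exact (continuous_const.mul (hdc.dotProduct (hAc.matrix_mulVec hdc))).continuousOn)
  set α := max α₀ 0 + 1 with hα
  have hα0 : 0 < α := by positivity
  have hαC : ∀ x ∈ C, (A x).trace + b x ⬝ᵥ (x - y).ofLp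
      < 2 * α * ((x - y).ofLp ⬝ᵥ (A x *ᵥ (x - y).ofLp)) := by
    intro x hx
    have h1 := hα₀ ⟨x, hx, rfl⟩
    have h2 : ((A x).trace + b x ⬝ᵥ (x - y).ofLp)
        / (2 * ((x - y).ofLp ⬝ᵥ (A x *ᵥ (x - y).ofLp))) < α := by
      refine lt_of_le_of_lt h1 ?_
      rw [hα]
      linarith [le_max_left α₀ 0]
    rw [div_lt_iff₀ (mul_pos two_pos (hpos x hx))] at h2
    linarith
  obtain ⟨ε, hε, hεS⟩ : ∃ ε > 0, ∀ x ∈ Metric.sphere k r, ‖x - y‖ ≤ ‖k - y‖ → φ x + ε < M := by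
    have hScpt : IsCompact (Metric.sphere k r ∩ {x | ‖x - y‖ ≤ ‖k - y‖}) :=
      (isCompact_sphere k r).inter_right (isClosed_le (by fun_prop) continuous_const)
    rcases (Metric.sphere k r ∩ {x | ‖x - y‖ ≤ ‖k - y‖}).eq_empty_or_nonempty with he | hne
    · exact ⟨1, one_pos, fun x h1 h2 => (Set.notMem_empty x (he ▸ ⟨h1, h2⟩)).elim⟩
    · obtain ⟨m, hm, hmax⟩ := hScpt.exists_isMaxOn hne hφ.continuous.continuousOn
      have hmM : φ m < M := by
        refine lt_of_le_of_ne (hp m) fun h => ?_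
        have h1 := huniq m h hm.2
        have h2 : dist m k = r := hm.1
        rw [h1, dist_self] at h2
        linarith
      refine ⟨(M - φ m) / 2, by linarith, fun x h1 h2 => ?_⟩
      have h3 : φ x ≤ φ m := hmax ⟨h1, h2⟩
      linarith
  have h1c : ContDiff ℝ ∞ fun x => -1 * φ x := contDiff_const.mul hφ
  have hqc : ContDiff ℝ ∞ (quadratic 1 y) := contDiff_quadratic 1 y
  have h2c : ContDiff ℝ ∞ fun x => -ε * Real.exp (-α * quadratic 1 y x) :=
    contDiff_const.mul (contDiff_const.mul hqc).exp
  set F : E n → ℝ := fun x => -1 * φ x + -ε * Real.exp (-α * quadratic 1 y x) with hF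
  have hFc : ContDiff ℝ ∞ F := h1c.add h2c
  have hkC : k ∈ C := Metric.mem_closedBall_self hr0.le
  obtain ⟨q, hqC, hq⟩ := hCc.exists_isMinOn ⟨k, hkC⟩ hFc.continuous.continuousOn
  have hqk : F q ≤ F k := hq hkC
  -- On the part of the sphere inside the touching ball φ falls short of M by more than ε, and the
  -- barrier is at most 1; outside that ball the barrier is smaller than at k.
  have hqS : q ∉ Metric.sphere k r := by
    intro hqS
    simp only [hF, quadratic_one, hkM] at hqk
    by_cases hle : ‖q - y‖ ≤ ‖k - y‖
    · have h1 := hεS q hqS hle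
      have h2 : Real.exp (-α * ‖q - y‖ ^ 2) ≤ 1 := by
        rw [Real.exp_le_one_iff]; nlinarith [sq_nonneg ‖q - y‖]
      have h3 := Real.exp_pos (-α * ‖k - y‖ ^ 2)
      nlinarith
    · have h1 : Real.exp (-α * ‖q - y‖ ^ 2) < Real.exp (-α * ‖k - y‖ ^ 2) := by
        rw [Real.exp_lt_exp]
        have h2 := pow_lt_pow_left₀ (not_le.mp hle) hR.le two_ne_zero
        nlinarith
      have h2 := hp q
      nlinarith
  have hloc : IsLocalMin F q := by
    have hqb : q ∈ Metric.ball k r :=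
      lt_of_le_of_ne (Metric.mem_closedBall.mp hqC) hqS
    filter_upwards [Metric.isOpen_ball.mem_nhds hqb] with x hx
      using hq (Metric.ball_subset_closedBall hx)
  have hid : ∀ c t : ℝ, HasDerivAt (fun s => c * s) c t := fun c t => by
    simpa using (hasDerivAt_id t).const_mul c
  have hid' : ∀ c t : ℝ, HasDerivAt (fun _ : ℝ => c) 0 t := fun c t => hasDerivAt_const t c
  have hg := grad_eq_zero_of_isLocalMin hloc
  have hH := posSemidef_of_isLocalMin hFc hloc
  rw [hF, grad_add (h1c.differentiable (by simp)) (h2c.differentiable (by simp)),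
    grad_comp (hid _) (hφ.differentiable (by simp)),
    grad_comp (hasDerivAt_const_mul_exp (-ε) (-α)) (hqc.differentiable (by simp)),
    grad_quadratic isHermitian_one, one_mulVec] at hg
  rw [hF, hessian_add h1c h2c, hessian_comp (hid _) (hid' _) hφ,
    hessian_comp (hasDerivAt_const_mul_exp (-ε) (-α)) (hasDerivAt_const_mul_exp _ _) hqc,
    hessian_quadratic isHermitian_one, grad_quadratic isHermitian_one, one_mulVec] at hH
  have htr := trace_mul_nonneg (hA q).posSemidef hH
  set X := Real.exp (-α * quadratic 1 y q) with hX
  have hX0 : 0 < X := Real.exp_pos _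
  set d := (q - y).ofLp with hd
  have hgφ : grad φ q = (2 * ε * α * X) • d := by
    rw [← sub_eq_zero, ← neg_eq_zero, ← hg]
    module
  have hLq := hL q
  rw [hgφ, dotProduct_smul, smul_eq_mul] at hLq
  simp only [Matrix.mul_add, Matrix.mul_smul, Matrix.trace_add, Matrix.trace_smul,
    trace_mul_vecMulVec, mulVec_smul, dotProduct_smul, smul_dotProduct, smul_eq_mul,
    Matrix.mul_one, zero_mul, add_zero] at htr
  have hα' := hαC q hqC
  have hεαX : 0 < 2 * ε * α * X := by positivity
  nlinarith [mul_lt_mul_of_pos_left hα' hεαX]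

end StrongMaximumPrinciple

/-! ## Entire convex solutions are quadratic -/

section Rigidity

variable {n : ℕ} {u : E n → ℝ}

theorem IsEntireConvexSolution.exists_phase_eq (hu : IsEntireConvexSolution u) :
    ∃ p, ∀ x, phase u x = phase u p := by
  obtain ⟨p, hp⟩ := hu.exists_phase_le
  have hGc : Continuous (hessian u) :=
    continuous_matrix fun i j => (contDiff_hessian hu.smooth i j).continuous
  refine ⟨p, eq_of_forall_le_of_subharmonic (contDiff_phase hu.smooth)
    -- Scaling the equation by the determinant turns the inverse into the adjugate, whose continuity
    -- is immediate.
    (A := fun x => (hessian u x).det • (hessian u x)⁻¹)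
    (b := fun x => -((hessian u x).det / 2) • x.ofLp)
    (fun x => (hu.convex x).inv.smul (hu.convex x).det_pos) ?_ ?_ (fun x => ?_) hp⟩
  · have h : (fun x => (hessian u x).det • (hessian u x)⁻¹) = fun x => (hessian u x).adjugate := by
      funext x
      rw [Matrix.inv_def, Ring.inverse_eq_inv', smul_smul,
        mul_inv_cancel₀ (hu.convex x).det_pos.ne', one_smul]
    rw [h]
    exact hGc.matrix_adjugate
  · have h := hGc.matrix_det
    fun_prop
  · rw [Matrix.smul_mul, Matrix.trace_smul, hu.trace_hessian_phase, smul_dotProduct]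
    simp only [smul_eq_mul]
    apply le_of_eq
    ring

theorem IsEntireConvexSolution.hessian_eq (hu : IsEntireConvexSolution u) (x : E n) :
    hessian u x = hessian u 0 := by
  obtain ⟨p, hp⟩ := hu.exists_phase_eq
  have hconst : phase u = fun _ => phase u p := funext hp
  have hg : ∀ y, grad (phase u) y = 0 := fun y => by
    ext i; rw [hconst]; simp [grad, partialDeriv]
  have hH : ∀ y, hessian (phase u) y = 0 := fun y => by
    ext i j
    have h : partialDeriv j (phase u) = fun _ => 0 := funext fun z => congrFun (hg z) j
    simp [hessian, h, partialDeriv]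
  ext i j
  have hline := hasDerivAt_hessian_line hu.smooth 0 x
  have hcont : Continuous fun t : ℝ => hessian u (0 + t • x) i j :=
    continuous_iff_continuousAt.mpr fun t => (hline t i j).continuousAt
  have hzero : ∀ t : ℝ, t ≠ 0 → hessianDeriv u (0 + t • x) x.ofLp i j = 0 := by
    intro t ht
    have h := hH (t • x)
    rw [hessian_phase hu.smooth] at h
    have h' : (1 / 2 : ℝ) * ∑ k, (t * x k) * partialDeriv k (fun y => hessian u y i j) (t • x)
      = 0 := congrFun (congrFun h i) j
    simp_rw [mul_assoc, ← Finset.mul_sum] at h'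
    rw [zero_add]
    exact (mul_eq_zero.mp ((mul_eq_zero.mp h').resolve_left (by norm_num))).resolve_left ht
  -- D²φ(tx) = 0 gives a vanishing ray derivative only after division by t; the mean value theorem
  -- picks t in the open interval, so t ≠ 0.
  obtain ⟨t, ht, hslope⟩ := exists_hasDerivAt_eq_slope _ _ zero_lt_one hcont.continuousOn
    fun t _ => hline t i j
  rw [hzero t ht.1.ne'] at hslope
  simp only [one_smul, zero_smul, zero_add, sub_zero, div_one] at hslope
  linarith

theorem IsEntireConvexSolution.grad_eq (hu : IsEntireConvexSolution u) (x : E n) :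
    grad u x = hessian u 0 *ᵥ x.ofLp := by
  obtain ⟨p, hp⟩ := hu.exists_phase_eq
  have hg : grad (phase u) x = 0 := by
    ext i
    rw [show phase u = fun _ => phase u p from funext hp]
    simp [grad, partialDeriv]
  rw [grad_phase hu.smooth, hu.hessian_eq] at hg
  exact (sub_eq_zero.mp ((smul_eq_zero.mp hg).resolve_left (by norm_num))).symm

theorem IsEntireConvexSolution.eq_quadratic (hu : IsEntireConvexSolution u) (x : E n) :
    u x = u 0 + (1 / 2 : ℝ) * inner ℝ (Matrix.toEuclideanLin (hessian u 0) x) x := by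
  set c := x.ofLp ⬝ᵥ (hessian u 0 *ᵥ x.ofLp) with hc
  have h1 : ∀ t : ℝ, HasDerivAt (fun t : ℝ => u (0 + t • x) - 1 / 2 * c * t ^ 2) 0 t := fun t => by
    refine ((hasDerivAt_line_real (hu.smooth.differentiable (by simp)) 0 x t).sub
      (((hasDerivAt_id t).pow 2).const_mul (1 / 2 * c))).congr_deriv ?_
    rw [hu.grad_eq, zero_add, WithLp.ofLp_smul, mulVec_smul, dotProduct_smul, ← hc]
    simp only [smul_eq_mul, id]
    ring
  have h2 := is_const_of_deriv_eq_zero (fun t => (h1 t).differentiableAt)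
    (fun t => (h1 t).deriv) 1 0
  have h3 : inner ℝ (Matrix.toEuclideanLin (hessian u 0) x) x = c := by
    rw [EuclideanSpace.inner_eq_star_dotProduct, star_trivial]
    rfl
  simp only [one_smul, zero_smul, zero_add] at h2
  rw [h3]
  linarith

end Rigidity

/-! ## Lagrangian graphs -/

section Graph

variable {n : ℕ} {f : E n → E n}

theorem inner_e_left (i : Fin n) (v : E n) : inner ℝ (e i) v = v i := by
  simp [e, EuclideanSpace.inner_single_left]

theorem inner_e_right (i : Fin n) (v : E n) : inner ℝ v (e i) = v i := by
  rw [real_inner_comm, inner_e_left]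

theorem partialDeriv_graphMap (hf : Differentiable ℝ f) (i : Fin n) (x : E n) :
    partialDeriv i (graphMap f) x = (e i, partialDeriv i f x) := by
  have h : HasFDerivAt (graphMap f) ((ContinuousLinearMap.id ℝ (E n)).prod (fderiv ℝ f x)) x :=
    (hasFDerivAt_id x).prodMk (hf x).hasFDerivAt
  rw [partialDeriv, h.fderiv]
  rfl

theorem partialDeriv_partialDeriv_graphMap (hf : ContDiff ℝ ∞ f) (i j : Fin n) (x : E n) :
    partialDeriv i (partialDeriv j (graphMap f)) x = (0, partialDeriv i (partialDeriv j f) x) := by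
  have h1 : partialDeriv j (graphMap f) = fun y => ((e j : E n), partialDeriv j f y) :=
    funext fun y => partialDeriv_graphMap (hf.differentiable (by simp)) j y
  have h : HasFDerivAt (fun y => ((e j : E n), partialDeriv j f y))
      ((0 : E n →L[ℝ] E n).prod (fderiv ℝ (partialDeriv j f) x)) x :=
    (hasFDerivAt_const (e j) x).prodMk
      ((contDiff_partialDeriv hf j).differentiable (by simp) x).hasFDerivAt
  rw [h1, partialDeriv, h.fderiv]
  rfl

theorem partialDeriv_apply (hf : Differentiable ℝ f) (i l : Fin n) (x : E n) :
    partialDeriv i (fun y => f y l) x = partialDeriv i f x l := by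
  have h := (EuclideanSpace.proj l : E n →L[ℝ] ℝ).hasFDerivAt.comp x (hf x).hasFDerivAt
  have h' : HasFDerivAt (fun y => f y l)
    ((EuclideanSpace.proj l : E n →L[ℝ] ℝ).comp (fderiv ℝ f x)) x := h
  rw [partialDeriv, h'.fderiv]
  rfl

theorem partialDeriv_symm_of_isLagrangian (hf : Differentiable ℝ f)
    (hL : IsLagrangian (graphMap f)) (x : E n) (i j : Fin n) :
    partialDeriv j f x i = partialDeriv i f x j := by
  have h := hL x i j
  rw [partialDeriv_graphMap hf, partialDeriv_graphMap hf, symplecticForm, inner_e_left,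
    inner_e_right] at h
  linarith

/-- A Lagrangian graph is the graph of a gradient. -/
theorem exists_potential (hf : ContDiff ℝ ∞ f) (hL : IsLagrangian (graphMap f)) :
    ∃ U : E n → ℝ, ContDiff ℝ ∞ U ∧ ∀ x, grad U x = (f x).ofLp := by
  have hfd := hf.differentiable (by simp)
  set η : E n → E n →L[ℝ] ℝ := fun x => innerSL ℝ (f x) with hη
  have hηc : ContDiff ℝ ∞ η := (innerSL ℝ).contDiff.comp hf
  have hd : ∀ a v w : E n, fderiv ℝ η a v w = ∑ i, ∑ j, v i * w j * partialDeriv i f a j := by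
    intro a v w
    have h : HasFDerivAt η ((innerSL ℝ).comp (fderiv ℝ f a)) a :=
      (innerSL ℝ (E := E n)).hasFDerivAt.comp a (hfd a).hasFDerivAt
    rw [h.fderiv, ContinuousLinearMap.comp_apply, fderiv_eq_sum]
    conv_lhs => rw [← sum_smul_e w]
    simp only [innerSL_apply_apply, sum_inner, inner_sum, real_inner_smul_left,
      real_inner_smul_right, inner_e_right]
    rw [Finset.sum_comm]
    exact Finset.sum_congr rfl fun i _ => Finset.sum_congr rfl fun j _ => by ring
  -- The Poincaré lemma for the one-form dual to f, closed by the Lagrangian condition.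
  obtain ⟨U, hU⟩ := convex_univ.exists_forall_hasFDerivAt_of_fderiv_symmetric isOpen_univ
    (hηc.differentiable (by simp)).differentiableOn fun a _ v w => by
      rw [hd, hd, Finset.sum_comm]
      refine Finset.sum_congr rfl fun i _ => Finset.sum_congr rfl fun j _ => ?_
      rw [partialDeriv_symm_of_isLagrangian hfd hL]
      ring
  have hUη : fderiv ℝ U = η := funext fun x => (hU x (Set.mem_univ x)).fderiv
  refine ⟨U, ?_, fun x => ?_⟩
  · rw [contDiff_infty_iff_fderiv, hUη]
    exact ⟨fun x => (hU x (Set.mem_univ x)).differentiableAt, hηc⟩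
  · ext i
    rw [grad, partialDeriv, hUη]
    simp only [hη, innerSL_apply_apply, inner_e_right]

theorem nullForm_add_left (p q r : Ambient n) :
    nullForm (p + q) r = nullForm p r + nullForm q r := by
  simp only [nullForm, Prod.fst_add, Prod.snd_add, inner_add_left]
  ring

theorem nullForm_smul_left (c : ℝ) (p r : Ambient n) :
    nullForm (c • p) r = c * nullForm p r := by
  simp only [nullForm, Prod.smul_fst, Prod.smul_snd, real_inner_smul_left]
  ring

theorem isLinearMap_normalPart (F : E n → Ambient n) (x : E n) :
    IsLinearMap ℝ (normalPart F x) where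
  map_add p q := by
    simp only [normalPart, nullForm_add_left, mul_add, add_smul, Finset.sum_add_distrib]
    abel
  map_smul c p := by
    simp only [normalPart, nullForm_smul_left, smul_sub, Finset.smul_sum, smul_smul]
    congr 1
    exact Finset.sum_congr rfl fun i _ => Finset.sum_congr rfl fun j _ => by ring_nf

theorem exists_eq_sum_of_normalPart_eq_zero {F : E n → Ambient n} {x : E n} {p : Ambient n}
    (h : normalPart F x p = 0) : ∃ c : Fin n → ℝ, p = ∑ k, c k • partialDeriv k F x := by
  refine ⟨fun j => ∑ i, (inducedMetric F x)⁻¹ i j * nullForm p (partialDeriv i F x), ?_⟩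
  rw [normalPart, sub_eq_zero, Finset.sum_comm] at h
  simp_rw [Finset.sum_smul]
  exact h

theorem inducedMetric_graphMap {U : E n → ℝ} (hU : ContDiff ℝ ∞ U) (hf : Differentiable ℝ f)
    (hUf : ∀ x, grad U x = (f x).ofLp) (x : E n) :
    inducedMetric (graphMap f) x = hessian U x := by
  have h : ∀ i j, partialDeriv i f x j = hessian U x i j := fun i j => by
    rw [hessian, of_apply, show partialDeriv j U = fun y => f y j from
      funext fun y => congrFun (hUf y) j, partialDeriv_apply hf]
  ext i j
  rw [inducedMetric, of_apply, partialDeriv_graphMap hf, partialDeriv_graphMap hf, nullForm,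
    inner_e_left, inner_e_right, h, h, ← (hessian_isHermitian hU x).apply i j, star_trivial]
  ring

theorem eq_ofLp_of_sum_smul_e_eq {c : Fin n → ℝ} {v : E n} (h : ∑ k, c k • (e k : E n) = v) :
    c = v.ofLp := by
  rw [← h]
  exact congrArg WithLp.ofLp (sum_smul_e (WithLp.toLp 2 c)).symm

/-- The self-shrinker equation for the graph of a gradient, in coordinates. -/
theorem trace_eq_of_isSelfShrinker {U : E n → ℝ} (hU : ContDiff ℝ ∞ U) (hf : ContDiff ℝ ∞ f)
    (hUf : ∀ x, grad U x = (f x).ofLp) (hS : IsSelfShrinker (graphMap f)) (x : E n) (l : Fin n) :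
    ((hessian U x)⁻¹ * hessianDeriv U x (e l : E n).ofLp).trace = grad (phase U) x l := by
  have hfd := hf.differentiable (by simp)
  have hUj : ∀ j, partialDeriv j U = fun y => f y j := fun j =>
    funext fun y => congrFun (hUf y) j
  have hUij : ∀ i j y, hessian U y i j = partialDeriv i f y j := fun i j y => by
    rw [hessian, of_apply, hUj, partialDeriv_apply hfd]
  set N := (isLinearMap_normalPart (graphMap f) x).mk' with hN
  have hNapp : ∀ p, normalPart (graphMap f) x p = N p := fun p => rfl
  set G := hessian U x with hG
  have h := hS x
  simp only [meanCurvature, secondFundamentalForm, hNapp,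
    inducedMetric_graphMap hU hfd hUf, ← hG] at h
  -- By linearity of the normal part, the equation says that gⁱʲ∂ᵢ∂ⱼF + ½F is tangent.
  have h0 : N ((∑ i, ∑ j, G⁻¹ i j • partialDeriv i (partialDeriv j (graphMap f)) x)
      + (1 / 2 : ℝ) • graphMap f x) = 0 := by
    simp only [map_add, map_sum, map_smul]
    rw [h, neg_add_cancel]
  obtain ⟨c, hc⟩ := exists_eq_sum_of_normalPart_eq_zero h0
  simp only [partialDeriv_partialDeriv_graphMap hf, partialDeriv_graphMap hfd] at hc
  have hc1 := congrArg Prod.fst hc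
  have hc2 := congrArg (fun p : Ambient n => p.2 l) hc
  simp only [Prod.fst_add, Prod.fst_sum, Prod.smul_fst, smul_zero, Finset.sum_const_zero,
    zero_add, graphMap] at hc1
  -- Second derivatives of a graph have zero first component, so the tangential coefficients must be
  -- x/2; the second component is then the desired equation.
  have hcx := eq_ofLp_of_sum_smul_e_eq hc1.symm
  simp only [Prod.snd_add, Prod.snd_sum, Prod.smul_snd, PiLp.add_apply, WithLp.ofLp_sum,
    Finset.sum_apply, PiLp.smul_apply, smul_eq_mul, graphMap, hcx, WithLp.ofLp_smul,
    Pi.smul_apply] at hc2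
  have hthird : ∀ i j, partialDeriv i (partialDeriv j f) x l
      = hessianDeriv U x (e l : E n).ofLp j i := by
    intro i j
    have h1 : hessianDeriv U x (e l : E n).ofLp j i
        = partialDeriv l (fun y => hessian U y j i) x := by
      simp [hessianDeriv, e]
    rw [h1, ← partialDeriv_apply ((contDiff_partialDeriv hf j).differentiable (by simp)),
      show (fun y => partialDeriv j f y l) = partialDeriv j (partialDeriv l U) from
        funext fun y => by rw [← hUij]; rfl,
      show (fun y => hessian U y j i) = partialDeriv j (partialDeriv i U) from rfl,
      partialDeriv_comm (contDiff_partialDeriv hU l), partialDeriv_comm (f := partialDeriv i U)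
        (contDiff_partialDeriv hU i),
      show partialDeriv i (partialDeriv l U) = partialDeriv l (partialDeriv i U) from
        funext fun y => partialDeriv_comm hU i l y]
  simp_rw [hthird] at hc2
  rw [grad_phase hU, hUf]
  simp only [Matrix.trace, Matrix.diag, Matrix.mul_apply, Pi.smul_apply, Pi.sub_apply, smul_eq_mul,
    mulVec, dotProduct]
  have h3 : ∑ k, 1 / 2 * x.ofLp k * (partialDeriv k f x).ofLp l
      = 1 / 2 * ∑ k, hessian U x l k * x.ofLp k := by
    rw [Finset.mul_sum]
    refine Finset.sum_congr rfl fun k _ => ?_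
    rw [← hUij, ← (hessian_isHermitian hU x).apply k l, star_trivial]
    ring
  rw [h3] at hc2
  linarith

theorem contDiff_log_det_hessian {U : E n → ℝ} (hU : ContDiff ℝ ∞ U)
    (hc : ∀ x, (hessian U x).PosDef) :
    ContDiff ℝ ∞ fun x => Real.log (hessian U x).det := by
  refine ContDiff.log ?_ fun x => (hc x).det_pos.ne'
  simp only [det_apply]
  refine ContDiff.sum fun σ _ => ContDiff.const_smul _ ?_
  exact contDiff_prod fun i _ => contDiff_hessian hU _ _

/-- A space-like Lagrangian self-shrinking entire graph is the graph of the gradient of an entire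
convex solution. -/
theorem exists_solution (hf : ContDiff ℝ ∞ f) (hsp : IsSpaceLike (graphMap f))
    (hL : IsLagrangian (graphMap f)) (hS : IsSelfShrinker (graphMap f)) :
    ∃ u : E n → ℝ, IsEntireConvexSolution u ∧ ∀ x, grad u x = (f x).ofLp := by
  have hfd := hf.differentiable (by simp)
  obtain ⟨U, hU, hUf⟩ := exists_potential hf hL
  have hpos : ∀ x, (hessian U x).PosDef := fun x => by
    rw [← inducedMetric_graphMap hU hfd hUf]; exact hsp x
  have hψ := contDiff_log_det_hessian hU hpos
  have hφ := contDiff_phase hU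
  have hgrad : ∀ x, grad (fun x => Real.log (hessian U x).det) x = grad (phase U) x := fun x => by
    ext l
    rw [← trace_eq_of_isSelfShrinker hU hf hUf hS, ← dotProduct_grad_log_det hU hpos
      (hψ.differentiable (by simp)) (fun _ => rfl)]
    simp [e]
  -- Equality of gradients leaves a constant. Subtracting c from U raises its phase by c and leaves
  -- the Hessian unchanged, so U − c solves the equation.
  set c : ℝ := Real.log (hessian U 0).det - phase U 0 with hc
  have hconst : ∀ x, Real.log (hessian U x).det - phase U x = c := fun x => by
    refine is_const_of_fderiv_eq_zero (𝕜 := ℝ)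
      ((hψ.differentiable (by simp)).fun_sub (hφ.differentiable (by simp))) (fun y => ?_) x 0
    ext v
    rw [fderiv_fun_sub (hψ.differentiable (by simp) y) (hφ.differentiable (by simp) y),
      _root_.sub_apply, fderiv_eq_dotProduct, fderiv_eq_dotProduct, hgrad, sub_self]
    rfl
  have hpd : ∀ j, partialDeriv j (fun x => U x - c) = partialDeriv j U := fun j => by
    funext y
    simp [partialDeriv, fderiv_sub_const]
  have hg : ∀ x, grad (fun x => U x - c) x = grad U x := fun x =>
    funext fun j => congrFun (hpd j) x
  have hH : ∀ x, hessian (fun x => U x - c) x = hessian U x := fun x => by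
    simp only [hessian, hpd]
  refine ⟨fun x => U x - c, ⟨hU.sub contDiff_const, fun x => by rw [hH]; exact hpos x, fun x => ?_⟩,
    fun x => by rw [hg, hUf]⟩
  rw [hH, inner_gradient_eq, hg]
  have h := hconst x
  rw [phase] at h
  linarith

theorem riemann_of_const {g : E n → Matrix (Fin n) (Fin n) ℝ} {g₀ : Matrix (Fin n) (Fin n) ℝ}
    (hg : ∀ x, g x = g₀) (x : E n) (l k i j : Fin n) : riemann g l k i j x = 0 := by
  have h : ∀ a b c, christoffel g a b c = fun _ => 0 := fun a b c => by
    funext y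
    simp [christoffel, hg, partialDeriv]
  simp [riemann, h, partialDeriv]

end Graph

end SelfShrinker

end

/-! ### Assembly of the two parts -/

theorem theorem1p1 (n : ℕ) :
    (∀ u : SelfShrinker.E n → ℝ, SelfShrinker.IsEntireConvexSolution u →
      ∀ x, u x = u 0 +
        (1 / 2 : ℝ) * inner ℝ (Matrix.toEuclideanLin (SelfShrinker.hessian u 0) x) x) ∧
    (∀ f : SelfShrinker.E n → SelfShrinker.E n, ContDiff ℝ ∞ f →
      SelfShrinker.IsSpaceLike (SelfShrinker.graphMap f) →
      SelfShrinker.IsLagrangian (SelfShrinker.graphMap f) →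
      SelfShrinker.IsSelfShrinker (SelfShrinker.graphMap f) →
      (∃ W : Submodule ℝ (SelfShrinker.Ambient n),
        Set.range (SelfShrinker.graphMap f) = (W : Set (SelfShrinker.Ambient n))) ∧
      SelfShrinker.IsTotallyGeodesic (SelfShrinker.graphMap f) ∧
      SelfShrinker.HasFlatMetric (SelfShrinker.graphMap f)) := by
  refine ⟨fun u hu => hu.eq_quadratic, fun f hf hsp hL hS => ?_⟩
  obtain ⟨u, hu, huf⟩ := SelfShrinker.exists_solution hf hsp hL hS
  have hfd := hf.differentiable (by simp)
  set T := Matrix.toEuclideanLin (SelfShrinker.hessian u 0) with hT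
  have hfT : ∀ x, f x = T x := fun x => by
    ext i
    rw [← huf, hu.grad_eq]
    rfl
  refine ⟨⟨T.graph, ?_⟩, fun x i j => ?_, fun x l k i j => ?_⟩
  · ext p
    simp only [Set.mem_range, SetLike.mem_coe, LinearMap.mem_graph_iff, SelfShrinker.graphMap, hfT]
    constructor
    · rintro ⟨y, rfl⟩
      rfl
    · intro h
      exact ⟨p.1, Prod.ext rfl h.symm⟩
  · have hconst : SelfShrinker.partialDeriv j f = fun _ => T (SelfShrinker.e j) := by
      funext y
      rw [SelfShrinker.partialDeriv, show f = T.toContinuousLinearMap from funext hfT,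
        ContinuousLinearMap.fderiv]
      rfl
    rw [SelfShrinker.secondFundamentalForm, SelfShrinker.partialDeriv_partialDeriv_graphMap hf,
      hconst, SelfShrinker.partialDeriv, fderiv_const_apply, _root_.zero_apply,
      Prod.mk_zero_zero]
    exact (SelfShrinker.isLinearMap_normalPart _ x).map_zero
  · exact SelfShrinker.riemann_of_const (fun y => by
      rw [SelfShrinker.inducedMetric_graphMap hu.smooth hfd huf, hu.hessian_eq]) x l k i j
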